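/- Let $\mathbb{T}=\mathbb{R}/2\pi\mathbb{Z}$. For $\alpha>0$ and $\mu\in\mathbb{R}$ let $\phi(k)=-k^{3}-2\mu k+\alpha k|k|$ $(k\in\mathbb{Z})$ be the phase function of the Benjamin equation, and let $\langle y\rangle=(1+|y|^2)^{1/2}$. For $s,b\in\mathbb{R}$ let $X_{s,b}$ be the closure, within the tempered distributions on $\mathbb{T}\times\mathbb{R}$, of the Schwartz space $\mathcal{S}(\mathbb{T}\times\mathbb{R})$ of complex-valued functions under the norm $$\|v\|_{X_{s,b}}=\Big(\sum_{k\in\mathbb{Z}}\int_{\mathbb{R}}\langle k\rangle^{2s}\langle\tau-\phi(k)\rangle^{2b}|\widehat v(k,\tau)|^2\,d\tau\Big)^{1/2},\qquad \widehat v(k,\tau)=\frac1{2\pi}\int_{\mathbb{R}}\int_{\mathbb{T}}v(x,t)e^{-i(t\tau+kx)}\,dx\,dt .$$ **Theorem.** For every $\alpha>0$ there is a constant $C_\alpha>0$, depending only on $\alpha$ (in particular not on $\mu$), such that the following hold for every $\mu\in\mathbb{R}$. 1. Every $v\in X_{0,1/3}$ is a function in $L^4(\mathbb{T}\times\mathbb{R})$,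 and $$\|v\|_{L^4(\mathbb{T}\times\mathbb{R})}\le C_\alpha\|v\|_{X_{0,1/3}}.$$ 2. Every $f\in L^{4/3}(\mathbb{T}\times\mathbb{R})$ belongs to $X_{0,-1/3}$, and $$\|f\|_{X_{0,-1/3}}\le C_\alpha\|f\|_{L^{4/3}(\mathbb{T}\times\mathbb{R})}.$$ -/

import Mathlib

open MeasureTheory Filter Topology
open scoped ENNReal NNReal ContDiff

noncomputable section

namespace Benjamin

/-- `0 < 2π`, so that the circle `ℝ / 2πℤ` carries its Lebesgue measure (of total mass `2π`). -/
instance fact_two_pi_pos : Fact (0 < 2 * Real.pi) := ⟨Real.two_pi_pos⟩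

/-- The cylinder `𝕋 × ℝ`, with `𝕋 = ℝ / 2πℤ`; a point is `(x, t)`. -/
abbrev Cyl : Type := AddCircle (2 * Real.pi) × ℝ

/-- The lift of a function on `𝕋 × ℝ` to a function on `ℝ × ℝ` that is `2π`-periodic in `x`. -/
def lift (v : Cyl → ℂ) : ℝ × ℝ → ℂ := fun p => v ((p.1 : AddCircle (2 * Real.pi)), p.2)

/-- The `(m, n)`-th Schwartz seminorm `sup |t|^m ‖D^n v(x, t)‖` of `v` is at most `B`. -/
def SeminormLE (v : Cyl → ℂ) (m n : ℕ) (B : ℝ) : Prop :=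
  ∀ p : ℝ × ℝ, |p.2| ^ m * ‖iteratedFDeriv ℝ n (lift v) p‖ ≤ B

/-- The space `𝒮(𝕋 × ℝ)` of Schwartz functions on the cylinder: smooth functions all of whose
derivatives decay rapidly in `t` (uniformly in `x`). -/
def Schwartz : Submodule ℂ (Cyl → ℂ) where
  carrier := {v | ContDiff ℝ ∞ (lift v) ∧ ∀ m n : ℕ, ∃ B : ℝ, SeminormLE v m n B}
  zero_mem' := by
    have h : lift (0 : Cyl → ℂ) = 0 := rfl
    refine ⟨by rw [h]; exact contDiff_const, fun m n => ⟨0, fun p => ?_⟩⟩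
    rw [h, iteratedFDeriv_zero]
    simp
  add_mem' := by
    rintro v w ⟨hv, hv'⟩ ⟨hw, hw'⟩
    have h : lift (v + w) = lift v + lift w := rfl
    refine ⟨by rw [h]; exact hv.add hw, fun m n => ?_⟩
    obtain ⟨B, hB⟩ := hv' m n
    obtain ⟨B', hB'⟩ := hw' m n
    refine ⟨B + B', fun p => ?_⟩
    rw [h, iteratedFDeriv_add (hv.of_le (by exact_mod_cast le_top))
      (hw.of_le (by exact_mod_cast le_top))]
    have h1 := hB p
    have h2 := hB' p
    have h3 := norm_add_le (iteratedFDeriv ℝ n (lift v) p) (iteratedFDeriv ℝ n (lift w) p)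
    have h4 : 0 ≤ |p.2| ^ m := by positivity
    calc _ ≤ |p.2| ^ m * (‖iteratedFDeriv ℝ n (lift v) p‖ + ‖iteratedFDeriv ℝ n (lift w) p‖) :=
          mul_le_mul_of_nonneg_left h3 h4
      _ ≤ B + B' := by rw [mul_add]; exact add_le_add h1 h2
  smul_mem' := by
    rintro c v ⟨hv, hv'⟩
    have h : lift (c • v) = c • lift v := rfl
    refine ⟨by rw [h]; exact hv.const_smul c, fun m n => ?_⟩
    obtain ⟨B, hB⟩ := hv' m n
    refine ⟨‖c‖ * B, fun p => ?_⟩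
    rw [h, iteratedFDeriv_const_smul_apply (hv.of_le (by exact_mod_cast le_top)).contDiffAt,
      norm_smul, mul_left_comm]
    exact mul_le_mul_of_nonneg_left (hB p) (norm_nonneg c)

/-- Tempered distributions on `𝕋 × ℝ`: linear functionals on `𝒮(𝕋 × ℝ)` that are continuous, i.e.
bounded by a constant times the maximum of finitely many Schwartz seminorms. -/
structure TemperedDist where
  toLinearMap : Schwartz →ₗ[ℂ] ℂ
  bounded' : ∃ (N : ℕ) (C : ℝ), ∀ (ψ : Schwartz) (B : ℝ),
    (∀ m ≤ N, ∀ n ≤ N, SeminormLE (ψ : Cyl → ℂ) m n B) → ‖toLinearMap ψ‖ ≤ C * B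

instance : CoeFun TemperedDist (fun _ => Schwartz → ℂ) := ⟨fun u => u.toLinearMap⟩

/-- The tempered distribution `u` is (given by) the function `f`:
`⟨u, ψ⟩ = ∫_{𝕋 × ℝ} f ψ dx dt` for every Schwartz function `ψ`. -/
def TemperedDist.IsFunction (u : TemperedDist) (f : Cyl → ℂ) : Prop :=
  ∀ ψ : Schwartz, Integrable (fun z => f z * (ψ : Cyl → ℂ) z) ∧
    u ψ = ∫ z, f z * (ψ : Cyl → ℂ) z

/-- The Fourier transform in both variables,
`v̂(k, τ) = (1 / 2π) ∫_ℝ ∫_𝕋 v(x, t) e^{-i(tτ + kx)} dx dt`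
(`fourier (-k) x` is `e^{-ikx}`). -/
def fourierST (v : Cyl → ℂ) (k : ℤ) (τ : ℝ) : ℂ :=
  (1 / (2 * Real.pi) : ℂ) * ∫ t : ℝ, ∫ x : AddCircle (2 * Real.pi),
    v (x, t) * fourier (-k) x * Complex.exp (-(Complex.I * t * τ))

/-- The phase function `φ(k) = -k³ - 2μk + αk|k|` of the Benjamin equation. -/
def phase (α μ : ℝ) (k : ℤ) : ℝ := -(k : ℝ) ^ 3 - 2 * μ * k + α * k * |(k : ℝ)|

/-- The bracket `⟨y⟩ = (1 + |y|²)^{1/2}`. -/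
def bracket (y : ℝ) : ℝ := Real.sqrt (1 + |y| ^ 2)

/-- The norm `(∑_k ∫ ⟨k⟩^{2s} ⟨τ - φ(k)⟩^{2b} |v̂(k, τ)|² dτ)^{1/2}` of a Schwartz function. -/
def schwartzNorm (α μ s b : ℝ) (v : Schwartz) : ℝ≥0∞ :=
  (∑' k : ℤ, ∫⁻ τ : ℝ,
    ENNReal.ofReal (bracket k ^ (2 * s) * bracket (τ - phase α μ k) ^ (2 * b)) *
      ‖fourierST (v : Cyl → ℂ) k τ‖ₑ ^ 2) ^ (1 / 2 : ℝ)

/-- The sequence `w` of Schwartz functions is Cauchy for the `X_{s,b}` norm and tends to `u`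
in the sense of tempered distributions. -/
structure Approximates (α μ s b : ℝ) (w : ℕ → Schwartz) (u : TemperedDist) : Prop where
  cauchy : Tendsto (fun p : ℕ × ℕ => schwartzNorm α μ s b (w p.1 - w p.2)) atTop (𝓝 0)
  tendsto : ∀ ψ : Schwartz,
    Tendsto (fun j => ∫ z, (w j : Cyl → ℂ) z * (ψ : Cyl → ℂ) z) atTop (𝓝 (u ψ))

/-- The Bourgain space `X_{s,b}`: the closure of the Schwartz functions under the `X_{s,b}` norm,
realized inside the tempered distributions on `𝕋 × ℝ`. -/
def bourgainSpace (α μ s b : ℝ) : Set TemperedDist :=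
  {u | ∃ w : ℕ → Schwartz, Approximates α μ s b w u}

/-- The norm of `X_{s,b}`: the limit of the norms of an approximating sequence of Schwartz
functions. The limit is the same for all such sequences (the transforms `ŵ_j` converge in the
weighted `L²` space, necessarily to `û`), so the infimum only picks this common value; it is `∞`
if `u` is not in `X_{s,b}`. -/
def bourgainNorm (α μ s b : ℝ) (u : TemperedDist) : ℝ≥0∞ :=
  sInf {N | ∃ w : ℕ → Schwartz, Approximates α μ s b w u ∧
    Tendsto (fun j => schwartzNorm α μ s b (w j)) atTop (𝓝 N)}

end Benjamin

end

noncomputable section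

namespace Benjamin

/-! Squaring turns the `L⁴` bound into an `L²` bound: the transform of `v²` at `(n, τ)` is, up to
constants, the sum over `k + l = n` of the convolutions of the modes of `v`. By Plancherel and a
weighted Cauchy–Schwarz inequality (`lintegral_trig_pow_four_le`) it suffices to bound, uniformly in
`n` and `τ`, the sum over these pairs of `∫ ⟨σ - φ(k)⟩^{-2/3} ⟨τ - σ - φ(l)⟩^{-2/3} dσ`, and each
integral is `≲ ⟨τ - φ(k) - φ(l)⟩^{-1/3}`.

If `k, l ≥ 0` and `d = 2k - n`, then `τ - φ(k) - φ(l) = c + κ d²` with `κ = (3n - 2α)/4`. The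
parameter `μ` enters only through `c`, so it does not affect the constant. Such a quadratic is at
least `|κ| (|d| - z)²` for some `z`, so the sum over the `n + 1` values of `k` is `≲ 1 + |κ|^{-1/3}
n^{1/3}`. This is bounded when `|κ| ≥ 1`; when `|κ| < 1`, the number of terms is bounded in terms of
`α` (`sum_phase_nonneg_le`). Pairs of opposite sign are avoided, since `φ(k) + φ(-k) = 0` for every
`k`: a sum is split into its frequencies `≥ 0` and `< 0`, and the oddness of `φ` reduces the latter
to the former.

This yields the estimate for finite trigonometric sums (`eLpNorm_trig_le`). Duality gives the
`L^{4/3}` bound for integrable functions (`dual_estimate`); duality once more, with the density of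
smooth trigonometric sums in `L^{4/3}`, gives the `L⁴` bound for all Schwartz functions
(`eLpNorm_four_le_schwartzNorm`). Both bounds pass to the closures: a Cauchy sequence for
`X_{0,1/3}` is Cauchy in `L⁴`, and a sequence converging in `L^{4/3}` is Cauchy for `X_{0,-1/3}`. -/

/-! ### Plancherel and convolution on the line. -/

open FourierTransform SchwartzMap in
/-- The Fourier integral of an `L¹ ∩ L²` function is its `L²` Fourier transform. -/
theorem fourier_toLp_ae_eq {f : ℝ → ℂ} (h1 : Integrable f) (h2 : MemLp f 2 volume) :
    (𝓕 h2.toLp : Lp ℂ 2 (volume : Measure ℝ)) =ᵐ[volume] (𝓕 f : ℝ → ℂ) := by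
  have hcont : Continuous (𝓕 f : ℝ → ℂ) :=
    VectorFourier.fourierIntegral_continuous Real.continuous_fourierChar
      (by exact continuous_inner) h1
  -- Both transforms are tested against smooth compactly supported `g`. The `L²` one moves onto `g`
  -- by its compatibility with tempered distributions, the integral one by Fubini.
  refine ae_eq_of_integral_contDiff_smul_eq
    ((Lp.memLp _).locallyIntegrable (by norm_num)) hcont.locallyIntegrable ?_
  intro g hg hgs
  have hg' : ContDiff ℝ ∞ (fun x => (g x : ℂ)) := Complex.ofRealCLM.contDiff.comp hg
  have hgs' : HasCompactSupport (fun x => (g x : ℂ)) :=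
    hgs.comp_left (g := fun y : ℝ => (y : ℂ)) rfl
  have key := congrArg (fun u => u (hgs'.toSchwartzMap hg'))
    (Lp.fourier_toTemperedDistribution_eq h2.toLp)
  simp only [TemperedDistribution.fourier_apply, Lp.toTemperedDistribution_apply] at key
  have e1 : ∀ (F : ℝ → ℂ), (∫ x, g x • F x) = ∫ x, (hgs'.toSchwartzMap hg') x • F x := by
    intro F; congr
  rw [e1, e1, ← key]
  have e2 : (∫ x, (𝓕 (hgs'.toSchwartzMap hg')) x • (h2.toLp : Lp ℂ 2 (volume : Measure ℝ)) x) =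
      ∫ x, (𝓕 (hgs'.toSchwartzMap hg')) x • f x := by
    apply integral_congr_ae
    filter_upwards [h2.coeFn_toLp] with x hx
    rw [hx]
  rw [e2, SchwartzMap.fourier_coe]
  simpa using! VectorFourier.integral_bilin_fourierIntegral_eq_flip (L := innerₗ ℝ)
    (ContinuousLinearMap.lsmul ℂ ℂ) Real.continuous_fourierChar continuous_inner
    (hgs'.toSchwartzMap hg').integrable h1

open FourierTransform in
/-- Plancherel's theorem for `L¹ ∩ L²`. -/
theorem lintegral_fourier_sq {f : ℝ → ℂ} (h1 : Integrable f) (h2 : MemLp f 2 volume) :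
    ∫⁻ ξ, ‖𝓕 f ξ‖ₑ ^ 2 = ∫⁻ x, ‖f x‖ₑ ^ 2 := by
  have h := congrArg (fun x : ℝ => ENNReal.ofReal x) (Lp.norm_fourier_eq (h2.toLp))
  simp only [Lp.norm_def] at h
  rw [ENNReal.ofReal_toReal (Lp.eLpNorm_ne_top _), ENNReal.ofReal_toReal (Lp.eLpNorm_ne_top _),
    eLpNorm_congr_ae (fourier_toLp_ae_eq h1 h2), eLpNorm_congr_ae h2.coeFn_toLp,
    eLpNorm_eq_lintegral_rpow_enorm_toReal (by norm_num) (by norm_num),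
    eLpNorm_eq_lintegral_rpow_enorm_toReal (by norm_num) (by norm_num)] at h
  have := ENNReal.rpow_left_injective (x := 1 / (2 : ℝ≥0∞).toReal) (by norm_num) h
  simpa using this

/-- The oscillatory integral `∫ G(τ) e^{itτ} dτ`. -/
def expT (G : ℝ → ℂ) (t : ℝ) : ℂ := ∫ τ : ℝ, G τ * Complex.exp (Complex.I * t * τ)

-- The transform `𝓕` has kernel `e^{-2πixξ}`, whence the dilation by `-1/(2π)`; its Jacobian is the
-- factor `2π` in `lintegral_expT_sq`.
open FourierTransform in
theorem expT_eq_fourier (G : ℝ → ℂ) (t : ℝ) : expT G t = 𝓕 G (-(1 / (2 * Real.pi)) * t) := by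
  rw [Real.fourier_real_eq_integral_exp_smul, expT]
  congr with τ
  rw [smul_eq_mul, mul_comm]
  congr 2
  have := Real.pi_ne_zero
  push_cast
  field_simp

theorem continuous_expT {G : ℝ → ℂ} (h : Integrable G) : Continuous (expT G) := by
  have hcont : Continuous (FourierTransform.fourier G : ℝ → ℂ) :=
    VectorFourier.fourierIntegral_continuous Real.continuous_fourierChar
      (by exact continuous_inner) h
  have : expT G = fun t => FourierTransform.fourier G (-(1 / (2 * Real.pi)) * t) :=
    funext (expT_eq_fourier G)
  rw [this]
  fun_prop

theorem lintegral_comp_mul_left_real (f : ℝ → ℝ≥0∞) (hf : Measurable f) {a : ℝ} (ha : a ≠ 0) :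
    ∫⁻ x, f (a * x) = ENNReal.ofReal |a⁻¹| * ∫⁻ x, f x := by
  have := lintegral_map (μ := volume) hf (measurable_const_mul a)
  rw [← this, Real.map_volume_mul_left ha, lintegral_smul_measure, smul_eq_mul]

theorem lintegral_expT_sq {G : ℝ → ℂ} (h1 : Integrable G) (h2 : MemLp G 2 volume) :
    ∫⁻ t, ‖expT G t‖ₑ ^ 2 = ENNReal.ofReal (2 * Real.pi) * ∫⁻ τ, ‖G τ‖ₑ ^ 2 := by
  have hcont : Continuous (FourierTransform.fourier G : ℝ → ℂ) :=
    VectorFourier.fourierIntegral_continuous Real.continuous_fourierChar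
      (by exact continuous_inner) h1
  simp_rw [expT_eq_fourier]
  rw [lintegral_comp_mul_left_real (fun t => ‖FourierTransform.fourier G t‖ₑ ^ 2)
    (by fun_prop) (by simp [Real.pi_ne_zero]), lintegral_fourier_sq h1 h2]
  congr 2
  rw [← neg_inv, abs_neg, one_div, inv_inv, abs_of_pos Real.two_pi_pos]

/-- Convolution of complex functions on the line. -/
def conv (G H : ℝ → ℂ) (τ : ℝ) : ℂ := ∫ σ : ℝ, G σ * H (τ - σ)

theorem conv_eq (G H : ℝ → ℂ) :
    conv G H = convolution G H (ContinuousLinearMap.mul ℂ ℂ) volume := by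
  ext τ
  simp [conv, convolution]

theorem integrable_conv {G H : ℝ → ℂ} (hG : Integrable G) (hH : Integrable H) :
    Integrable (conv G H) := by
  rw [conv_eq]
  exact hG.integrable_convolution (ContinuousLinearMap.mul ℂ ℂ) hH

theorem expT_conv {G H : ℝ → ℂ} (hG : Integrable G) (hH : Integrable H) (t : ℝ) :
    expT (conv G H) t = expT G t * expT H t := by
  rw [expT_eq_fourier, expT_eq_fourier, expT_eq_fourier, conv_eq,
    Real.fourier_mul_convolution_eq hG hH]

/-- An integrable bounded function is square integrable. -/
theorem memLp_two_of_bounded {f : ℝ → ℂ} (h : Integrable f) {C : ℝ} (hC : ∀ x, ‖f x‖ ≤ C) :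
    MemLp f 2 volume := by
  refine (memLp_two_iff_integrable_sq_norm h.aestronglyMeasurable).2 ?_
  refine (h.norm.const_mul C).mono' (by fun_prop) ?_
  filter_upwards with x
  rw [Real.norm_of_nonneg (by positivity), pow_two]
  exact mul_le_mul_of_nonneg_right (hC x) (norm_nonneg _)

theorem norm_conv_le {G H : ℝ → ℂ} (hG : Integrable G) {C : ℝ} (hC : ∀ x, ‖H x‖ ≤ C) (τ : ℝ) :
    ‖conv G H τ‖ ≤ (∫ σ, ‖G σ‖) * C := by
  rw [← integral_mul_const]
  refine norm_integral_le_of_norm_le (hG.norm.mul_const C) ?_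
  filter_upwards with σ
  rw [norm_mul]
  exact mul_le_mul_of_nonneg_left (hC _) (norm_nonneg _)

theorem enorm_conv_le (G H : ℝ → ℂ) (τ : ℝ) :
    ‖conv G H τ‖ₑ ≤ ∫⁻ σ, ‖G σ‖ₑ * ‖H (τ - σ)‖ₑ := by
  refine (enorm_integral_le_lintegral_enorm _).trans_eq ?_
  simp_rw [enorm_mul]

/-! ### Counting pairs of frequencies near a level set of the phase. -/

/-- Telescoping: if `a³ - b³ = 1` with `0 ≤ b ≤ a`, then `1 = (a - b)(a² + ab + b²) ≤ 3a²(a - b)`.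
-/
theorem sum_rpow_neg_two_thirds_le (n : ℕ) :
    ∑ j ∈ Finset.range n, ((j + 1 : ℕ) : ℝ) ^ (-(2 / 3) : ℝ) ≤ 3 * (n : ℝ) ^ (1 / 3 : ℝ) := by
  induction n with
  | zero => simp
  | succ n ih =>
    rw [Finset.sum_range_succ]
    set a : ℝ := ((n + 1 : ℕ) : ℝ) ^ (1 / 3 : ℝ) with ha
    set b : ℝ := (n : ℝ) ^ (1 / 3 : ℝ) with hb
    have ha0 : 0 < a := by positivity
    have hb0 : 0 ≤ b := by positivity
    have ha3 : a ^ 3 = n + 1 := by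
      rw [ha, ← Real.rpow_natCast, ← Real.rpow_mul (by positivity)]; norm_num
    have hb3 : b ^ 3 = n := by
      rw [hb, ← Real.rpow_natCast, ← Real.rpow_mul (by positivity)]; norm_num
    have hinv : ((n + 1 : ℕ) : ℝ) ^ (-(2 / 3) : ℝ) = (a ^ 2)⁻¹ := by
      rw [ha, ← Real.rpow_natCast, ← Real.rpow_mul (by positivity),
        ← Real.rpow_neg (by positivity)]; norm_num
    have hba : b ≤ a := Real.rpow_le_rpow (by positivity) (by push_cast; linarith) (by norm_num)
    have : (a ^ 2)⁻¹ ≤ 3 * (a - b) := by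
      rw [inv_le_iff_one_le_mul₀ (by positivity)]
      nlinarith [mul_nonneg (sub_nonneg.2 hba) (sub_nonneg.2 (pow_le_pow_left₀ hb0 hba 2)),
        mul_nonneg (sub_nonneg.2 hba) (mul_nonneg ha0.le (sub_nonneg.2 hba))]
    rw [hinv]
    linarith

/-- Values of an antitone function at the distances from `|2k - n|` to a point. -/
theorem sum_antitone_dist_le (n : ℕ) {z : ℝ} (hz : 0 ≤ z) {F : ℝ → ℝ}
    (hF : ∀ x y, 0 ≤ x → x ≤ y → F y ≤ F x) (hF0 : ∀ x, 0 ≤ F x) :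
    ∑ k ∈ Finset.range (n + 1), F |((|2 * (k : ℤ) - n| : ℤ) : ℝ) - z| ≤
      4 * ∑ j ∈ Finset.range (n + 1), F j := by
  set e : ℕ → ℕ := fun k => (2 * (k : ℤ) - n).natAbs with he
  -- `J k` is an integer below the distance from `|2k - n|` to `z`. The minimum with `n` keeps it in
  -- `range (n + 1)` when `z` is large.
  set J : ℕ → ℕ := fun k => if z ≤ e k then e k - ⌈z⌉₊ else min ⌊z⌋₊ n - e k with hJ
  -- The sign of `2k - n`, the side of `z`, and `J k` together determine `k`. So each value of `J`
  -- occurs at most four times, which is the factor 4.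
  set i : ℕ → (Bool × Bool) × ℕ := fun k => ((decide (n ≤ 2 * k), decide (z ≤ e k)), J k) with hi
  have hen : ∀ k ∈ Finset.range (n + 1), e k ≤ n := by
    intro k hk; simp only [Finset.mem_range] at hk; simp only [he]; omega
  have hle : ∀ k ∈ Finset.range (n + 1),
      F |((|2 * (k : ℤ) - n| : ℤ) : ℝ) - z| ≤ F ((i k).2 : ℝ) := by
    intro k hk
    have h1 : ((|2 * (k : ℤ) - n| : ℤ) : ℝ) = (e k : ℝ) := by
      simp only [he]; rw [Int.abs_eq_natAbs]; simp
    rw [h1]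
    refine hF _ _ (Nat.cast_nonneg _) ?_
    simp only [hi, hJ]
    split_ifs with h
    · have h2 : ⌈z⌉₊ ≤ e k := Nat.ceil_le.2 h
      rw [Nat.cast_sub h2]
      have := Nat.le_ceil z
      exact le_trans (by linarith) (le_abs_self _)
    · push Not at h
      have h2 : e k ≤ min ⌊z⌋₊ n := le_min (Nat.le_floor h.le) (hen k hk)
      rw [Nat.cast_sub h2]
      have h3 := Nat.floor_le hz
      have h4 : ((min ⌊z⌋₊ n : ℕ) : ℝ) ≤ (⌊z⌋₊ : ℝ) := by exact_mod_cast min_le_left _ _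
      rw [abs_sub_comm]
      exact le_trans (by linarith) (le_abs_self _)
  have hinj : Set.InjOn i (Finset.range (n + 1) : Set ℕ) := by
    intro k hk l hl hkl
    have hk' := hen k hk
    have hl' := hen l hl
    simp only [hi, hJ, Prod.mk.injEq, decide_eq_decide] at hkl
    obtain ⟨⟨h1, h2⟩, h3⟩ := hkl
    have hel : e k = e l := by
      by_cases h : z ≤ e k
      · rw [if_pos h, if_pos (h2.1 h)] at h3
        have a1 : ⌈z⌉₊ ≤ e k := Nat.ceil_le.2 h
        have a2 : ⌈z⌉₊ ≤ e l := Nat.ceil_le.2 (h2.1 h)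
        omega
      · have h' : ¬ z ≤ e l := fun hh => h (h2.2 hh)
        rw [if_neg h, if_neg h'] at h3
        push Not at h h'
        have a1 : e k ≤ min ⌊z⌋₊ n := le_min (Nat.le_floor h.le) hk'
        have a2 : e l ≤ min ⌊z⌋₊ n := le_min (Nat.le_floor h'.le) hl'
        omega
    simp only [he] at hel
    by_cases hn : n ≤ 2 * k
    · have := h1.1 hn; omega
    · have : ¬ n ≤ 2 * l := fun hh => hn (h1.2 hh)
      omega
  have hmaps : Finset.image i (Finset.range (n + 1)) ⊆
      (Finset.univ : Finset (Bool × Bool)) ×ˢ Finset.range (n + 1) := by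
    intro p hp
    obtain ⟨k, hk, rfl⟩ := Finset.mem_image.1 hp
    have := hen k hk
    simp only [Finset.mem_product, Finset.mem_univ, true_and, Finset.mem_range, hi, hJ]
    split_ifs <;> omega
  calc _ ≤ ∑ k ∈ Finset.range (n + 1), F ((i k).2 : ℝ) := Finset.sum_le_sum hle
    _ = ∑ p ∈ Finset.image i (Finset.range (n + 1)), F (p.2 : ℝ) :=
      (Finset.sum_image hinj (f := fun p : (Bool × Bool) × ℕ => F (p.2 : ℝ))).symm
    _ ≤ ∑ p ∈ (Finset.univ : Finset (Bool × Bool)) ×ˢ Finset.range (n + 1), F (p.2 : ℝ) :=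
      Finset.sum_le_sum_of_subset_of_nonneg hmaps fun _ _ _ => hF0 _
    _ = _ := by
      rw [Finset.sum_product]; simp

/-- A quadratic `c + κ d²` is at least `|κ| (|d| - z)²` in absolute value, for some `z ≥ 0`. -/
theorem exists_le_abs_quadratic (c : ℝ) {κ : ℝ} (hκ : κ ≠ 0) :
    ∃ z : ℝ, 0 ≤ z ∧ ∀ d : ℝ, |κ| * (|d| - z) ^ 2 ≤ |c + κ * d ^ 2| := by
  have e : ∀ d : ℝ, |c + κ * d ^ 2| = |κ| * |d ^ 2 + c / κ| := by
    intro d; rw [← abs_mul]; congr 1; field_simp; ring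
  rcases le_total 0 (c / κ) with h | h
  · refine ⟨0, le_rfl, fun d => ?_⟩
    rw [e, sub_zero, sq_abs]
    exact mul_le_mul_of_nonneg_left (le_trans (by linarith) (le_abs_self _)) (abs_nonneg _)
  -- Here `z` is the positive root: `d² - z² = (|d| - z)(|d| + z)` and `||d| - z| ≤ |d| + z`.
  · refine ⟨Real.sqrt (-(c / κ)), Real.sqrt_nonneg _, fun d => ?_⟩
    set z := Real.sqrt (-(c / κ)) with hz
    have hz2 : z ^ 2 = -(c / κ) := Real.sq_sqrt (by linarith)
    have hz0 : 0 ≤ z := Real.sqrt_nonneg _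
    rw [e]
    refine mul_le_mul_of_nonneg_left ?_ (abs_nonneg _)
    have : d ^ 2 + c / κ = (|d| - z) * (|d| + z) := by rw [← sq_abs d]; nlinarith
    rw [this, abs_mul, abs_of_nonneg (add_nonneg (abs_nonneg d) hz0), ← sq_abs (|d| - z), pow_two]
    refine mul_le_mul_of_nonneg_left ?_ (abs_nonneg _)
    rw [abs_le]
    constructor <;> nlinarith [abs_nonneg d]

/-- Sums over the points `d = 2k - n` of the quadratic `c + κ d²`. -/
theorem sum_quadratic_le (n : ℕ) (c : ℝ) {κ : ℝ} (hκ : 1 ≤ |κ|) {R : ℝ} (hn : (n : ℝ) ≤ R * |κ|) :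
    ∑ k ∈ Finset.range (n + 1), (max 1 |c + κ * (2 * (k : ℝ) - n) ^ 2|) ^ (-(1 / 3) : ℝ) ≤
      4 * (1 + 3 * R ^ (1 / 3 : ℝ)) := by
  have hκ0 : κ ≠ 0 := by rintro rfl; norm_num at hκ
  have hκp : 0 < |κ| := by linarith
  have hR : 0 ≤ R := by
    by_contra h
    push Not at h
    have : (0 : ℝ) ≤ n := n.cast_nonneg
    nlinarith
  obtain ⟨z, hz, hq⟩ := exists_le_abs_quadratic c hκ0
  set F : ℝ → ℝ := fun x => (max 1 (|κ| * x ^ 2)) ^ (-(1 / 3) : ℝ) with hF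
  have hF0 : ∀ x, 0 ≤ F x := fun x => by positivity
  have hFanti : ∀ x y, 0 ≤ x → x ≤ y → F y ≤ F x := by
    intro x y hx hxy
    refine Real.rpow_le_rpow_of_nonpos (by positivity) ?_ (by norm_num)
    gcongr
  calc _ ≤ ∑ k ∈ Finset.range (n + 1), F |((|2 * (k : ℤ) - n| : ℤ) : ℝ) - z| := by
        refine Finset.sum_le_sum fun k _ => ?_
        refine Real.rpow_le_rpow_of_nonpos (by positivity) ?_ (by norm_num)
        have := hq (2 * (k : ℝ) - n)
        rw [sq_abs]
        push_cast
        exact max_le_max le_rfl this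
    _ ≤ 4 * ∑ j ∈ Finset.range (n + 1), F j := sum_antitone_dist_le n hz hFanti hF0
    _ ≤ _ := by
      gcongr
      -- The term `j = 0` gives 1; the others are at most `|κ|^{-1/3} j^{-2/3}`. Since `∑ j^{-2/3}`
      -- diverges, the restriction to `j ≤ n` and the bound `n ≤ R |κ|` are both needed.
      rw [Finset.sum_range_succ']
      have h0 : F ((0 : ℕ) : ℝ) = 1 := by simp [hF]
      have hj : ∀ j ∈ Finset.range n, F ((j + 1 : ℕ) : ℝ) ≤
          |κ| ^ (-(1 / 3) : ℝ) * ((j + 1 : ℕ) : ℝ) ^ (-(2 / 3) : ℝ) := by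
        intro j _
        have hp : (0 : ℝ) < ((j + 1 : ℕ) : ℝ) := by positivity
        calc F ((j + 1 : ℕ) : ℝ) ≤ (|κ| * ((j + 1 : ℕ) : ℝ) ^ 2) ^ (-(1 / 3) : ℝ) :=
              Real.rpow_le_rpow_of_nonpos (by positivity) (le_max_right _ _) (by norm_num)
          _ = _ := by
              rw [Real.mul_rpow hκp.le (by positivity), ← Real.rpow_natCast,
                ← Real.rpow_mul hp.le]
              norm_num
      have hsum := Finset.sum_le_sum hj
      rw [← Finset.mul_sum] at hsum
      have h1 : |κ| ^ (-(1 / 3) : ℝ) * (n : ℝ) ^ (1 / 3 : ℝ) ≤ R ^ (1 / 3 : ℝ) := by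
        calc _ ≤ |κ| ^ (-(1 / 3) : ℝ) * (R * |κ|) ^ (1 / 3 : ℝ) := by gcongr
          _ = _ := by
            rw [Real.mul_rpow hR hκp.le, mul_left_comm, ← Real.rpow_add hκp]; norm_num
      have h2 := mul_le_mul_of_nonneg_left (sum_rpow_neg_two_thirds_le n)
        (Real.rpow_nonneg hκp.le (-(1 / 3) : ℝ))
      rw [h0]
      nlinarith

/-- With `d = 2k - n`, one has `k³ + (n - k)³ = n³/4 + (3n/4) d²` and `k² + (n - k)² = (n² + d²)/2`,
so the argument is a quadratic in `d` with leading coefficient `(3n - 2α)/4`. The linear term of the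
phase contributes only the constant `2μn`. -/
theorem sum_phase_nonneg_le {α : ℝ} (hα : 0 < α) :
    ∃ B : ℝ, 0 < B ∧ ∀ (μ τ : ℝ) (n : ℕ),
      ∑ k ∈ Finset.range (n + 1),
        (max 1 |τ - phase α μ k - phase α μ (n - k)|) ^ (-(1 / 3) : ℝ) ≤ B := by
  -- From `3n = 4κ + 2α`: `n ≤ R |κ|` if `|κ| ≥ 1`, and `n ≤ R` otherwise.
  set R : ℝ := (4 + 2 * α) / 3 with hR
  have hR0 : 0 < R := by positivity
  refine ⟨(R + 1) + 4 * (1 + 3 * R ^ (1 / 3 : ℝ)), by positivity, fun μ τ n => ?_⟩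
  set κ : ℝ := (3 * n - 2 * α) / 4 with hκ
  by_cases h : 1 ≤ |κ|
  · have hn : (n : ℝ) ≤ R * |κ| := by
      have : 4 * κ = 3 * n - 2 * α := by rw [hκ]; ring
      have h2 : κ ≤ |κ| := le_abs_self κ
      rw [hR]
      nlinarith
    have := sum_quadratic_le n (τ + (n : ℝ) ^ 3 / 4 + 2 * μ * n - α * n ^ 2 / 2) h hn
    refine le_trans (le_of_eq ?_) (this.trans (by linarith))
    refine Finset.sum_congr rfl fun k hk => ?_
    have hk' : (k : ℝ) ≤ n := by
      have := Finset.mem_range.1 hk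
      exact_mod_cast (by omega : k ≤ n)
    congr 3
    simp only [phase, Int.cast_natCast, Int.cast_sub]
    rw [abs_of_nonneg (Nat.cast_nonneg k), abs_of_nonneg (sub_nonneg.2 hk')]
    rw [hκ]
    ring
  · push Not at h
    have hn : (n : ℝ) ≤ R := by
      have : 4 * κ = 3 * n - 2 * α := by rw [hκ]; ring
      have h2 : κ ≤ |κ| := le_abs_self κ
      rw [hR]
      linarith
    calc _ ≤ ∑ k ∈ Finset.range (n + 1), (1 : ℝ) := by
          refine Finset.sum_le_sum fun k _ => ?_
          exact Real.rpow_le_one_of_one_le_of_nonpos (le_max_left _ _) (by norm_num)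
      _ = n + 1 := by simp
      _ ≤ _ := by
          have : 0 < 4 * (1 + 3 * R ^ (1 / 3 : ℝ)) := by positivity
          linarith

theorem phase_neg (α μ : ℝ) (k : ℤ) : phase α μ (-k) = -phase α μ k := by
  simp only [phase, Int.cast_neg, abs_neg]; ring

/-- The counting estimate for pairs of frequencies `≥ 0` with a given sum. -/
theorem sum_pairs_nonneg_le {α : ℝ} (hα : 0 < α) :
    ∃ B : ℝ, 0 < B ∧ ∀ (μ τ : ℝ) (K : Finset ℤ), (∀ k ∈ K, 0 ≤ k) → ∀ n : ℤ,
      ∑ p ∈ K ×ˢ K with p.1 + p.2 = n,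
        (max 1 |τ - phase α μ p.1 - phase α μ p.2|) ^ (-(1 / 3) : ℝ) ≤ B := by
  obtain ⟨B, hB, h⟩ := sum_phase_nonneg_le hα
  refine ⟨B, hB, fun μ τ K hK n => ?_⟩
  set S := (K ×ˢ K).filter (fun p : ℤ × ℤ => p.1 + p.2 = n) with hS
  have hmem : ∀ p ∈ S, 0 ≤ p.1 ∧ 0 ≤ p.2 ∧ p.1 + p.2 = n := by
    intro p hp
    simp only [hS, Finset.mem_filter, Finset.mem_product] at hp
    exact ⟨hK _ hp.1.1, hK _ hp.1.2, hp.2⟩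
  have hinj : Set.InjOn (fun p : ℤ × ℤ => p.1.toNat) (S : Set (ℤ × ℤ)) := by
    intro p hp q hq hpq
    have h1 := hmem p hp
    have h2 := hmem q hq
    simp only at hpq
    ext <;> omega
  set g : ℕ → ℝ := fun k =>
    (max 1 |τ - phase α μ k - phase α μ ((n.toNat : ℤ) - k)|) ^ (-(1 / 3) : ℝ) with hg
  calc _ = ∑ p ∈ S, g p.1.toNat := by
        refine Finset.sum_congr rfl fun p hp => ?_
        obtain ⟨h1, h2, h3⟩ := hmem p hp
        have e1 : (p.1.toNat : ℤ) = p.1 := by omega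
        have e2 : (n.toNat : ℤ) - p.1 = p.2 := by omega
        simp only [hg]
        rw [e1, e2]
    _ = ∑ k ∈ S.image (fun p : ℤ × ℤ => p.1.toNat), g k := (Finset.sum_image hinj).symm
    _ ≤ ∑ k ∈ Finset.range (n.toNat + 1), g k := by
        refine Finset.sum_le_sum_of_subset_of_nonneg ?_ fun _ _ _ => by positivity
        intro k hk
        obtain ⟨p, hp, rfl⟩ := Finset.mem_image.1 hk
        have := hmem p hp
        simp only [Finset.mem_range]
        omega
    _ ≤ B := h μ τ n.toNat

/-- The counting estimate for pairs of frequencies of the same sign with a given sum. -/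
theorem sum_pairs_le {α : ℝ} (hα : 0 < α) :
    ∃ B : ℝ, 0 < B ∧ ∀ (μ τ : ℝ) (K : Finset ℤ), ((∀ k ∈ K, 0 ≤ k) ∨ (∀ k ∈ K, k ≤ 0)) →
      ∀ n : ℤ, ∑ p ∈ K ×ˢ K with p.1 + p.2 = n,
        (max 1 |τ - phase α μ p.1 - phase α μ p.2|) ^ (-(1 / 3) : ℝ) ≤ B := by
  obtain ⟨B, hB, h⟩ := sum_pairs_nonneg_le hα
  refine ⟨B, hB, fun μ τ K hK n => ?_⟩
  rcases hK with hK | hK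
  · exact h μ τ K hK n
  -- The phase is odd, so `(k, τ) ↦ (-k, -τ)` reduces to nonnegative frequencies.
  · refine le_trans (le_of_eq ?_) (h μ (-τ) (K.image Neg.neg) (by simpa using hK) (-n))
    refine Finset.sum_nbij' (fun p => (-p.1, -p.2)) (fun p => (-p.1, -p.2)) ?_ ?_ ?_ ?_ ?_
    · intro p hp
      simp only [Finset.mem_filter, Finset.mem_product, Finset.mem_image, neg_inj,
        exists_eq_right] at hp ⊢
      exact ⟨hp.1, by omega⟩
    · intro p hp
      simp only [Finset.mem_filter, Finset.mem_product, Finset.mem_image] at hp ⊢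
      obtain ⟨⟨⟨a, ha, ha'⟩, ⟨b, hb, hb'⟩⟩, hn⟩ := hp
      rw [← ha', ← hb', neg_neg, neg_neg]
      exact ⟨⟨ha, hb⟩, by omega⟩
    · intro p _; simp
    · intro p _; simp
    · intro p _
      simp only [phase_neg]
      rw [← abs_neg (τ - _ - _)]
      congr 3
      ring

/-! ### Convolution of the weights. -/

/-- The weight `⟨y⟩^{-2/3}`, up to constants. -/
def wt (y : ℝ) : ℝ := (max 1 |y|) ^ (-(2 / 3) : ℝ)

theorem wt_pos (y : ℝ) : 0 < wt y := by unfold wt; positivity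

theorem continuous_wt : Continuous wt := by
  unfold wt
  exact (continuous_const.max continuous_abs).rpow_const fun x => Or.inl (by positivity)

theorem wt_neg (y : ℝ) : wt (-y) = wt y := by simp [wt]

/-- Split at `A`: both `∫_0^A σ^{-2/3} A^{-2/3} dσ` and `∫_A^∞ σ^{-4/3} dσ` equal `3 A^{-1/3}`. -/
theorem lintegral_Ioi_wt_min_le {A : ℝ} (hA : 1 ≤ A) :
    ∫⁻ σ in Set.Ioi (0 : ℝ), ENNReal.ofReal (wt σ * min (wt σ) (A ^ (-(2 / 3) : ℝ))) ≤
      ENNReal.ofReal (6 * A ^ (-(1 / 3) : ℝ)) := by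
  have hA0 : 0 < A := by linarith
  have hm : ∀ σ : ℝ, 0 < σ → wt σ ≤ σ ^ (-(2 / 3) : ℝ) := fun σ hσ =>
    Real.rpow_le_rpow_of_nonpos hσ ((le_abs_self σ).trans (le_max_right _ _)) (by norm_num)
  rw [← Set.Ioc_union_Ioi_eq_Ioi hA0.le,
    lintegral_union measurableSet_Ioi (Set.Ioc_disjoint_Ioi le_rfl)]
  have h1 : ∫⁻ σ in Set.Ioc 0 A, ENNReal.ofReal (wt σ * min (wt σ) (A ^ (-(2 / 3) : ℝ))) ≤
      ENNReal.ofReal (3 * A ^ (-(1 / 3) : ℝ)) := by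
    calc _ ≤ ∫⁻ σ in Set.Ioc 0 A, ENNReal.ofReal (σ ^ (-(2 / 3) : ℝ) * A ^ (-(2 / 3) : ℝ)) := by
          refine setLIntegral_mono' measurableSet_Ioc fun σ hσ => ENNReal.ofReal_le_ofReal ?_
          have := (wt_pos σ).le
          exact mul_le_mul (hm σ hσ.1) (min_le_right _ _) (le_min this (by positivity))
            (Real.rpow_nonneg hσ.1.le _)
      _ = ENNReal.ofReal (∫ σ in Set.Ioc 0 A, σ ^ (-(2 / 3) : ℝ) * A ^ (-(2 / 3) : ℝ)) := by
          rw [ofReal_integral_eq_lintegral_ofReal]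
          · have := (intervalIntegral.intervalIntegrable_rpow' (a := 0) (b := A)
              (r := (-(2 / 3) : ℝ)) (by norm_num)).mul_const (A ^ (-(2 / 3) : ℝ))
            exact (intervalIntegrable_iff_integrableOn_Ioc_of_le hA0.le).1 this
          · filter_upwards [ae_restrict_mem measurableSet_Ioc] with σ hσ
            have := hσ.1
            positivity
      _ = _ := by
          rw [integral_mul_const, ← intervalIntegral.integral_of_le hA0.le,
            integral_rpow (Or.inl (by norm_num))]
          congr 1
          rw [Real.zero_rpow (by norm_num), sub_zero, div_mul_eq_mul_div, ← Real.rpow_add hA0]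
          norm_num
          ring
  have h2 : ∫⁻ σ in Set.Ioi A, ENNReal.ofReal (wt σ * min (wt σ) (A ^ (-(2 / 3) : ℝ))) ≤
      ENNReal.ofReal (3 * A ^ (-(1 / 3) : ℝ)) := by
    calc _ ≤ ∫⁻ σ in Set.Ioi A, ENNReal.ofReal (σ ^ (-(4 / 3) : ℝ)) := by
          refine setLIntegral_mono' measurableSet_Ioi fun σ hσ => ENNReal.ofReal_le_ofReal ?_
          have hσ0 : 0 < σ := hA0.trans hσ
          have := (wt_pos σ).le
          calc _ ≤ σ ^ (-(2 / 3) : ℝ) * σ ^ (-(2 / 3) : ℝ) :=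
                mul_le_mul (hm σ hσ0) ((min_le_left _ _).trans (hm σ hσ0))
                  (le_min this (by positivity)) (by positivity)
            _ = _ := by rw [← Real.rpow_add hσ0]; norm_num
      _ = ENNReal.ofReal (∫ σ in Set.Ioi A, σ ^ (-(4 / 3) : ℝ)) := by
          rw [ofReal_integral_eq_lintegral_ofReal]
          · exact integrableOn_Ioi_rpow_of_lt (by norm_num) hA0
          · filter_upwards [ae_restrict_mem measurableSet_Ioi] with σ hσ
            have : 0 < σ := hA0.trans hσ
            positivity
      _ = _ := by
          rw [integral_Ioi_rpow_of_lt (by norm_num) hA0]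
          congr 1
          norm_num
          ring
  refine (add_le_add h1 h2).trans_eq ?_
  rw [← ENNReal.ofReal_add (by positivity) (by positivity)]
  congr 1; ring

theorem lintegral_wt_min_le {A : ℝ} (hA : 1 ≤ A) :
    ∫⁻ σ : ℝ, ENNReal.ofReal (wt σ * min (wt σ) (A ^ (-(2 / 3) : ℝ))) ≤
      ENNReal.ofReal (12 * A ^ (-(1 / 3) : ℝ)) := by
  have h := lintegral_Ioi_wt_min_le hA
  set f : ℝ → ℝ≥0∞ := fun σ => ENNReal.ofReal (wt σ * min (wt σ) (A ^ (-(2 / 3) : ℝ))) with hf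
  have hneg : ∫⁻ σ in Set.Iic 0, f σ = ∫⁻ σ in Set.Ioi 0, f σ := by
    have e := (Measure.measurePreserving_neg (volume : Measure ℝ)).setLIntegral_comp_preimage_emb
      (MeasurableEquiv.neg ℝ).measurableEmbedding f (Set.Ici 0)
    have e2 : ∀ σ, f (-σ) = f σ := fun σ => by simp only [hf, wt_neg]
    simp only [e2] at e
    rw [show (Neg.neg ⁻¹' Set.Ici (0 : ℝ)) = Set.Iic 0 by ext; simp] at e
    rw [e, setLIntegral_congr Ioi_ae_eq_Ici]
  have hu : ∫⁻ σ, f σ = (∫⁻ σ in Set.Iic 0, f σ) + ∫⁻ σ in Set.Ioi 0, f σ := by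
    rw [← lintegral_union measurableSet_Ioi (Set.Iic_disjoint_Ioi le_rfl), Set.Iic_union_Ioi,
      setLIntegral_univ]
  rw [hu, hneg]
  refine (add_le_add h h).trans_eq ?_
  rw [← ENNReal.ofReal_add (by positivity) (by positivity)]
  congr 1; ring

/-- `∫ ⟨σ⟩^{-2/3} ⟨a - σ⟩^{-2/3} dσ ≲ ⟨a⟩^{-1/3}`. -/
theorem lintegral_wt_mul_wt_le (a : ℝ) :
    ∫⁻ σ : ℝ, ENNReal.ofReal (wt σ) * ENNReal.ofReal (wt (a - σ)) ≤
      ENNReal.ofReal (48 * (max 1 |a|) ^ (-(1 / 3) : ℝ)) := by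
  set A : ℝ := max 1 (|a| / 2) with hA
  have hA1 : 1 ≤ A := le_max_left _ _
  have hA0 : 0 < A := by linarith
  set f : ℝ → ℝ := fun σ => wt σ * min (wt σ) (A ^ (-(2 / 3) : ℝ)) with hf
  have hf0 : ∀ σ, 0 ≤ f σ := fun σ =>
    mul_nonneg (wt_pos σ).le (le_min (wt_pos σ).le (by positivity))
  have hfc : Continuous f := continuous_wt.mul (continuous_wt.min continuous_const)
  -- The larger of the two arguments is at least `|a|/2` in modulus, so its weight is below both the
  -- other weight and `A^{-2/3}`.
  have key : ∀ x y : ℝ, x + y = a → |x| ≤ |y| → wt x * wt y ≤ f x := by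
    intro x y hxy h
    refine mul_le_mul_of_nonneg_left (le_min ?_ ?_) (wt_pos x).le
    · exact Real.rpow_le_rpow_of_nonpos (by positivity) (max_le_max le_rfl h) (by norm_num)
    · refine Real.rpow_le_rpow_of_nonpos hA0 (max_le_max le_rfl ?_) (by norm_num)
      have := abs_add_le x y
      rw [hxy] at this
      linarith
  have hpt : ∀ σ, wt σ * wt (a - σ) ≤ f σ + f (a - σ) := by
    intro σ
    rcases le_total |σ| |a - σ| with h | h
    · linarith [key σ (a - σ) (by ring) h, hf0 (a - σ)]
    · linarith [key (a - σ) σ (by ring) h, hf0 σ, mul_comm (wt σ) (wt (a - σ))]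
  calc _ ≤ ∫⁻ σ : ℝ, (ENNReal.ofReal (f σ) + ENNReal.ofReal (f (a - σ))) := by
        refine lintegral_mono fun σ => ?_
        rw [← ENNReal.ofReal_mul (wt_pos σ).le, ← ENNReal.ofReal_add (hf0 _) (hf0 _)]
        exact ENNReal.ofReal_le_ofReal (hpt σ)
    _ = 2 * ∫⁻ σ : ℝ, ENNReal.ofReal (f σ) := by
        rw [lintegral_add_left (by fun_prop),
          lintegral_sub_left_eq_self (fun σ => ENNReal.ofReal (f σ)) a, two_mul]
    _ ≤ 2 * ENNReal.ofReal (12 * A ^ (-(1 / 3) : ℝ)) := by gcongr; exact lintegral_wt_min_le hA1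
    _ ≤ _ := by
        rw [show (2 : ℝ≥0∞) = ENNReal.ofReal 2 by simp, ← ENNReal.ofReal_mul (by norm_num)]
        -- `48 = 2 · 12 · 2`; the last 2 bounds the `2^{1/3}` lost in replacing `A` by `max 1 |a|`.
        refine ENNReal.ofReal_le_ofReal ?_
        have hle : max 1 |a| / 2 ≤ A := by
          rw [hA]
          rcases le_total 1 |a| with h | h
          · rw [max_eq_right h]; exact le_max_right _ _
          · rw [max_eq_left h]; exact le_trans (by norm_num) (le_max_left _ _)
        have h1 : A ^ (-(1 / 3) : ℝ) ≤ (max 1 |a| / 2) ^ (-(1 / 3) : ℝ) :=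
          Real.rpow_le_rpow_of_nonpos (by positivity) hle (by norm_num)
        rw [Real.div_rpow (by positivity) (by norm_num)] at h1
        have h2 : (max 1 |a|) ^ (-(1 / 3) : ℝ) / 2 ^ (-(1 / 3) : ℝ) ≤
            2 * (max 1 |a|) ^ (-(1 / 3) : ℝ) := by
          rw [div_eq_mul_inv, ← Real.rpow_neg (by norm_num), mul_comm]
          refine mul_le_mul_of_nonneg_right ?_ (by positivity)
          calc (2 : ℝ) ^ (-(-(1 / 3)) : ℝ) ≤ 2 ^ (1 : ℝ) :=
                Real.rpow_le_rpow_of_exponent_le (by norm_num) (by norm_num)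
            _ = 2 := by norm_num
        linarith

/-! ### The `L⁴` estimate for trigonometric sums. -/

/-- The weighted Cauchy–Schwarz inequality. -/
theorem sq_lintegral_mul_le {X : Type*} [MeasurableSpace X] {m : Measure X} {r f g : X → ℝ≥0∞}
    (hr : Measurable r) (hf : Measurable f) (hg : Measurable g) (h0 : ∀ x, r x ≠ 0)
    (ht : ∀ x, r x ≠ ⊤) :
    (∫⁻ x, f x * g x ∂m) ^ 2 ≤
      (∫⁻ x, r x * f x ^ 2 ∂m) * ∫⁻ x, (r x)⁻¹ * g x ^ 2 ∂m := by
  have hc := ENNReal.lintegral_mul_le_Lp_mul_Lq m Real.HolderConjugate.two_two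
    (f := fun x => r x ^ (1 / 2 : ℝ) * f x) (g := fun x => (r x)⁻¹ ^ (1 / 2 : ℝ) * g x)
    (by fun_prop) (by fun_prop)
  have e1 : ∀ x, ((fun x => r x ^ (1 / 2 : ℝ) * f x) * fun x => (r x)⁻¹ ^ (1 / 2 : ℝ) * g x) x =
      f x * g x := by
    intro x
    simp only [Pi.mul_apply]
    rw [mul_mul_mul_comm, ← ENNReal.mul_rpow_of_nonneg _ _ (by norm_num),
      ENNReal.mul_inv_cancel (h0 x) (ht x), ENNReal.one_rpow, one_mul]
  have e2 : ∀ x y : ℝ≥0∞, (x ^ (1 / 2 : ℝ) * y) ^ (2 : ℝ) = x * y ^ 2 := by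
    intro x y
    rw [ENNReal.mul_rpow_of_nonneg _ _ (by norm_num), ← ENNReal.rpow_mul]; norm_num
  simp_rw [e1, e2] at hc
  calc _ ≤ ((∫⁻ x, r x * f x ^ 2 ∂m) ^ (1 / 2 : ℝ) *
        (∫⁻ x, (r x)⁻¹ * g x ^ 2 ∂m) ^ (1 / 2 : ℝ)) ^ 2 := by gcongr
    _ = _ := by
        rw [mul_pow, ← ENNReal.rpow_natCast, ← ENNReal.rpow_natCast, ← ENNReal.rpow_mul,
          ← ENNReal.rpow_mul]
        norm_num

theorem sq_lintegral_le {X : Type*} [MeasurableSpace X] {m : Measure X} {r h : X → ℝ≥0∞}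
    (hr : Measurable r) (hh : Measurable h) (h0 : ∀ x, r x ≠ 0) (ht : ∀ x, r x ≠ ⊤) :
    (∫⁻ x, h x ∂m) ^ 2 ≤ (∫⁻ x, r x ∂m) * ∫⁻ x, (r x)⁻¹ * h x ^ 2 ∂m := by
  simpa using sq_lintegral_mul_le (m := m) hr (measurable_const (a := (1 : ℝ≥0∞))) hh h0 ht

theorem sq_sum_le_of_sq_le {ι : Type*} (s : Finset ι) {x u v : ι → ℝ≥0∞}
    (h : ∀ i ∈ s, x i ^ 2 ≤ u i * v i) :
    (∑ i ∈ s, x i) ^ 2 ≤ (∑ i ∈ s, u i) * ∑ i ∈ s, v i := by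
  have hc := ENNReal.inner_le_Lp_mul_Lq s (fun i => u i ^ (1 / 2 : ℝ))
    (fun i => v i ^ (1 / 2 : ℝ)) Real.HolderConjugate.two_two
  have e2 : ∀ y : ℝ≥0∞, (y ^ (1 / 2 : ℝ)) ^ (2 : ℝ) = y := by
    intro x; rw [← ENNReal.rpow_mul]; norm_num
  simp_rw [e2] at hc
  have hx : ∀ i ∈ s, x i ≤ u i ^ (1 / 2 : ℝ) * v i ^ (1 / 2 : ℝ) := by
    intro i hi
    have := ENNReal.rpow_le_rpow (h i hi) (by norm_num : (0 : ℝ) ≤ 1 / 2)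
    rw [ENNReal.mul_rpow_of_nonneg _ _ (by norm_num), ← ENNReal.rpow_natCast,
      ← ENNReal.rpow_mul] at this
    simpa using this
  calc _ ≤ ((∑ i ∈ s, u i) ^ (1 / 2 : ℝ) * (∑ i ∈ s, v i) ^ (1 / 2 : ℝ)) ^ 2 := by
        gcongr; exact (Finset.sum_le_sum hx).trans hc
    _ = _ := by
        rw [mul_pow, ← ENNReal.rpow_natCast, ← ENNReal.rpow_natCast, ← ENNReal.rpow_mul,
          ← ENNReal.rpow_mul]
        norm_num

theorem integral_fourier_mul_conj (n m : ℤ) :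
    ∫ x : AddCircle (2 * Real.pi), fourier n x * (starRingEnd ℂ) (fourier m x) =
      if n = m then ((2 * Real.pi : ℝ) : ℂ) else 0 := by
  have h := congrFun (fourierCoeff_fourier (T := 2 * Real.pi) n) m
  rw [fourierCoeff] at h
  have e : ∀ x : AddCircle (2 * Real.pi), fourier n x * (starRingEnd ℂ) (fourier m x) =
      fourier (-m) x • fourier n x := by
    intro x; rw [fourier_neg, smul_eq_mul, mul_comm]
  simp_rw [e]
  rw [AddCircle.integral_haarAddCircle, inv_smul_eq_iff₀ Real.two_pi_pos.ne'] at h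
  rw [h, Pi.single_apply]
  simp only [eq_comm (a := m)]
  split_ifs <;> simp

/-- Orthogonality of the exponentials on the circle. -/
theorem lintegral_sum_fourier_sq (N : Finset ℤ) (c : ℤ → ℂ) :
    ∫⁻ x : AddCircle (2 * Real.pi), ‖∑ n ∈ N, fourier n x * c n‖ₑ ^ 2 =
      ENNReal.ofReal (2 * Real.pi) * ∑ n ∈ N, ‖c n‖ₑ ^ 2 := by
  set f : AddCircle (2 * Real.pi) → ℂ := fun x => ∑ n ∈ N, fourier n x * c n with hf
  have hfc : Continuous f := by fun_prop
  have hint : ∀ g : AddCircle (2 * Real.pi) → ℂ, Continuous g → Integrable g := fun g hg =>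
    hg.integrable_of_hasCompactSupport (HasCompactSupport.of_compactSpace g)
  have h1 : ∫ x, (f x * (starRingEnd ℂ) (f x)) =
      ((2 * Real.pi * ∑ n ∈ N, ‖c n‖ ^ 2 : ℝ) : ℂ) := by
    have e : ∀ x, f x * (starRingEnd ℂ) (f x) = ∑ n ∈ N, ∑ m ∈ N,
        (c n * (starRingEnd ℂ) (c m)) * (fourier n x * (starRingEnd ℂ) (fourier m x)) := by
      intro x
      simp only [hf, map_sum, map_mul]
      rw [Finset.sum_mul_sum]
      refine Finset.sum_congr rfl fun n _ => Finset.sum_congr rfl fun m _ => ?_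
      ring
    have e2 : ∀ n, ∫ x, ∑ m ∈ N, (c n * (starRingEnd ℂ) (c m)) *
        (fourier n x * (starRingEnd ℂ) (fourier m (x : AddCircle (2 * Real.pi)))) =
        ∑ m ∈ N, (c n * (starRingEnd ℂ) (c m)) *
          if n = m then ((2 * Real.pi : ℝ) : ℂ) else 0 := by
      intro n
      rw [integral_finsetSum _ fun m _ => hint _ (by fun_prop)]
      simp_rw [integral_const_mul, integral_fourier_mul_conj]
    simp_rw [e]
    rw [integral_finsetSum _ fun n _ => hint _ (by fun_prop)]
    simp_rw [e2]
    push_cast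
    rw [Finset.mul_sum]
    refine Finset.sum_congr rfl fun n hn => ?_
    simp only [mul_ite, mul_zero, Finset.sum_ite_eq, hn, if_true]
    rw [Complex.mul_conj, Complex.normSq_eq_norm_sq]
    push_cast; ring
  have h2 : ∫ x, ‖f x‖ ^ 2 = 2 * Real.pi * ∑ n ∈ N, ‖c n‖ ^ 2 := by
    have e : ∀ x, f x * (starRingEnd ℂ) (f x) = ((‖f x‖ ^ 2 : ℝ) : ℂ) := by
      intro x; rw [Complex.mul_conj, Complex.normSq_eq_norm_sq]
    simp_rw [e] at h1
    rw [integral_complex_ofReal] at h1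
    exact_mod_cast h1
  have h3 : ∀ z : ℂ, ‖z‖ₑ ^ 2 = ENNReal.ofReal (‖z‖ ^ 2) := by
    intro z; rw [ENNReal.ofReal_pow (norm_nonneg _), ofReal_norm]
  have hint2 : Integrable (fun x => ‖f x‖ ^ 2) :=
    (show Continuous fun x => ‖f x‖ ^ 2 by fun_prop).integrable_of_hasCompactSupport
      (HasCompactSupport.of_compactSpace _)
  simp_rw [h3]
  rw [← ofReal_integral_eq_lintegral_ofReal hint2 (ae_of_all _ fun x => by positivity), h2,
    ENNReal.ofReal_mul Real.two_pi_pos.le,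
    ENNReal.ofReal_sum_of_nonneg fun _ _ => by positivity]

/-- The function `∑_{k ∈ K} e^{ikx} ∫ G_k(τ) e^{itτ} dτ` on the cylinder. -/
def trig (K : Finset ℤ) (G : ℤ → ℝ → ℂ) (z : Cyl) : ℂ :=
  ∑ k ∈ K, fourier k z.1 * expT (G k) z.2

theorem continuous_trig (K : Finset ℤ) {G : ℤ → ℝ → ℂ} (h : ∀ k, Integrable (G k)) :
    Continuous (trig K G) := by
  unfold trig
  refine continuous_finsetSum _ fun k _ => ?_
  have := continuous_expT (h k)
  fun_prop

theorem expT_sum {ι : Type*} (s : Finset ι) {G : ι → ℝ → ℂ} (h : ∀ i ∈ s, Integrable (G i))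
    (t : ℝ) : expT (fun τ => ∑ i ∈ s, G i τ) t = ∑ i ∈ s, expT (G i) t := by
  unfold expT
  simp_rw [Finset.sum_mul]
  rw [integral_finsetSum]
  intro i hi
  refine (h i hi).mul_bdd (c := 1) (by fun_prop) (ae_of_all _ fun τ => ?_)
  rw [mul_assoc, ← Complex.ofReal_mul, mul_comm, Complex.norm_exp_ofReal_mul_I]

/-- Pairs of modes are grouped by their total frequency; `expT` turns each convolution into a
product. -/
theorem trig_sq (K : Finset ℤ) {G : ℤ → ℝ → ℂ} (hG : ∀ k, Integrable (G k))
    (x : AddCircle (2 * Real.pi))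
    (t : ℝ) : trig K G (x, t) * trig K G (x, t) =
      ∑ n ∈ (K ×ˢ K).image (fun p => p.1 + p.2), fourier n x *
        expT (fun τ => ∑ p ∈ K ×ˢ K with p.1 + p.2 = n, conv (G p.1) (G p.2) τ) t := by
  have e : ∀ n : ℤ, fourier n x *
      expT (fun τ => ∑ p ∈ K ×ˢ K with p.1 + p.2 = n, conv (G p.1) (G p.2) τ) t =
      ∑ p ∈ K ×ˢ K with p.1 + p.2 = n,
        (fourier p.1 x * expT (G p.1) t) * (fourier p.2 x * expT (G p.2) t) := by
    intro n
    rw [expT_sum _ fun p _ => integrable_conv (hG p.1) (hG p.2), Finset.mul_sum]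
    refine Finset.sum_congr rfl fun p hp => ?_
    rw [expT_conv (hG _) (hG _), ← (Finset.mem_filter.1 hp).2, fourier_add]
    ring
  simp_rw [e]
  rw [Finset.sum_fiberwise_of_maps_to fun p hp => Finset.mem_image_of_mem _ hp]
  simp only [trig]
  rw [Finset.sum_mul_sum, Finset.sum_product]

theorem lintegral_lintegral_mul_sub {a b : ℝ → ℝ≥0∞} (ha : Measurable a) (hb : Measurable b) :
    ∫⁻ τ, ∫⁻ σ, a σ * b (τ - σ) = (∫⁻ σ, a σ) * ∫⁻ σ, b σ := by
  rw [lintegral_lintegral_swap (by fun_prop)]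
  have : ∀ σ, ∫⁻ τ, a σ * b (τ - σ) = a σ * ∫⁻ τ, b τ := by
    intro σ
    rw [lintegral_const_mul _ (by fun_prop), lintegral_sub_right_eq_self b σ]
  simp_rw [this]
  rw [lintegral_mul_const _ ha]

/-- The weighted bilinear estimate: a bound for the convolutions of the weights bounds the `L⁴`
norm by the weighted `L²` norm on the Fourier side. -/
theorem lintegral_trig_pow_four_le (K : Finset ℤ) {G : ℤ → ℝ → ℂ} (hG : ∀ k, Integrable (G k))
    (hGm : ∀ k, Measurable (G k)) (hGb : ∀ k, ∃ C : ℝ, ∀ τ, ‖G k τ‖ ≤ C)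
    {ρ : ℤ → ℝ → ℝ≥0∞} (hρ : ∀ k, Measurable (ρ k)) (hρ0 : ∀ k τ, ρ k τ ≠ 0)
    (hρt : ∀ k τ, ρ k τ ≠ ⊤) {B : ℝ≥0∞}
    (hB : ∀ n τ, ∑ p ∈ K ×ˢ K with p.1 + p.2 = n, ∫⁻ σ, ρ p.1 σ * ρ p.2 (τ - σ) ≤ B) :
    ∫⁻ z, ‖trig K G z‖ₑ ^ 4 ≤ ENNReal.ofReal (2 * Real.pi) ^ 2 * B *
      (∑ k ∈ K, ∫⁻ τ, (ρ k τ)⁻¹ * ‖G k τ‖ₑ ^ 2) ^ 2 := by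
  set a : ℤ → ℝ → ℝ≥0∞ := fun k τ => (ρ k τ)⁻¹ * ‖G k τ‖ₑ ^ 2 with ha
  have ham : ∀ k, Measurable (a k) := fun k => by
    have := hρ k; have := hGm k; simp only [ha]; fun_prop
  set N := (K ×ˢ K).image (fun p => p.1 + p.2) with hN
  set H : ℤ → ℝ → ℂ := fun n τ => ∑ p ∈ K ×ˢ K with p.1 + p.2 = n, conv (G p.1) (G p.2) τ with hH
  have hHi : ∀ n, Integrable (H n) := fun n =>
    integrable_finsetSum _ fun p _ => integrable_conv (hG _) (hG _)
  have hH2 : ∀ n, MemLp (H n) 2 volume := by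
    intro n
    refine memLp_finsetSum _ fun p _ => ?_
    obtain ⟨C, hC⟩ := hGb p.2
    exact memLp_two_of_bounded (integrable_conv (hG _) (hG _)) (norm_conv_le (hG p.1) hC)
  have hHb : ∀ n τ, ‖H n τ‖ₑ ^ 2 ≤
      B * ∑ p ∈ K ×ˢ K with p.1 + p.2 = n, ∫⁻ σ, a p.1 σ * a p.2 (τ - σ) := by
    intro n τ
    calc ‖H n τ‖ₑ ^ 2 ≤ (∑ p ∈ K ×ˢ K with p.1 + p.2 = n,
          ∫⁻ σ, ‖G p.1 σ‖ₑ * ‖G p.2 (τ - σ)‖ₑ) ^ 2 := by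
          gcongr
          exact (enorm_sum_le _ _).trans (Finset.sum_le_sum fun p _ => enorm_conv_le _ _ _)
      _ ≤ (∑ p ∈ K ×ˢ K with p.1 + p.2 = n, ∫⁻ σ, ρ p.1 σ * ρ p.2 (τ - σ)) *
          ∑ p ∈ K ×ˢ K with p.1 + p.2 = n, ∫⁻ σ, a p.1 σ * a p.2 (τ - σ) := by
          -- Cauchy–Schwarz in `σ` with weight `ρ ρ` for each pair, then in the sum over pairs.
          refine sq_sum_le_of_sq_le _ fun p _ => ?_
          have m1 := hρ p.1
          have m2 := hρ p.2
          have m3 := hGm p.1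
          have m4 := hGm p.2
          refine (sq_lintegral_le (r := fun σ => ρ p.1 σ * ρ p.2 (τ - σ)) (by fun_prop)
            (by fun_prop) (fun σ => mul_ne_zero (hρ0 _ _) (hρ0 _ _))
            (fun σ => ENNReal.mul_ne_top (hρt _ _) (hρt _ _))).trans_eq ?_
          congr 1
          refine lintegral_congr fun σ => ?_
          rw [ENNReal.mul_inv (Or.inl (hρ0 _ _)) (Or.inl (hρt _ _))]
          simp only [ha]
          ring
      _ ≤ _ := by gcongr; exact hB n τ
  calc ∫⁻ z, ‖trig K G z‖ₑ ^ 4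
      = ∫⁻ t : ℝ, ∫⁻ x : AddCircle (2 * Real.pi), ‖trig K G (x, t)‖ₑ ^ 4 := by
        rw [Measure.volume_eq_prod, lintegral_prod_symm]
        have := continuous_trig K hG
        fun_prop
    -- Parseval in `x` for the square of the sum, at fixed `t`; Plancherel in `t` follows.
    _ = ∫⁻ t : ℝ, ENNReal.ofReal (2 * Real.pi) * ∑ n ∈ N, ‖expT (H n) t‖ₑ ^ 2 := by
        refine lintegral_congr fun t => ?_
        rw [← lintegral_sum_fourier_sq N fun n => expT (H n) t]
        refine lintegral_congr fun x => ?_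
        rw [← trig_sq K hG, enorm_mul]
        ring
    _ = ENNReal.ofReal (2 * Real.pi) ^ 2 * ∑ n ∈ N, ∫⁻ τ, ‖H n τ‖ₑ ^ 2 := by
        have hm : ∀ n, Continuous (expT (H n)) := fun n => continuous_expT (hHi n)
        rw [lintegral_const_mul _ (Finset.measurable_sum _ fun n _ => by
            have := hm n; fun_prop),
          lintegral_finsetSum _ fun n _ => by have := hm n; fun_prop]
        simp_rw [lintegral_expT_sq (hHi _) (hH2 _)]
        rw [← Finset.mul_sum, pow_two, mul_assoc]
    _ ≤ ENNReal.ofReal (2 * Real.pi) ^ 2 * ∑ n ∈ N, B *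
        ∑ p ∈ K ×ˢ K with p.1 + p.2 = n, (∫⁻ σ, a p.1 σ) * ∫⁻ σ, a p.2 σ := by
        gcongr with n _
        refine (lintegral_mono (hHb n)).trans_eq ?_
        have hmm : ∀ p : ℤ × ℤ, Measurable fun τ => ∫⁻ σ, a p.1 σ * a p.2 (τ - σ) := by
          intro p
          have m1 := ham p.1
          have m2 := ham p.2
          exact Measurable.lintegral_prod_right' (f := fun q : ℝ × ℝ => a p.1 q.2 * a p.2 (q.1 - q.2))
            (by fun_prop)
        rw [lintegral_const_mul _ (Finset.measurable_sum _ fun p _ => hmm p),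
          lintegral_finsetSum _ fun p _ => hmm p]
        simp_rw [lintegral_lintegral_mul_sub (ham _) (ham _)]
    _ = _ := by
        -- The fibres `p.1 + p.2 = n` partition `K ×ˢ K`, so the decoupled products reassemble into
        -- a square.
        rw [← Finset.mul_sum, Finset.sum_fiberwise_of_maps_to
          fun p hp => Finset.mem_image_of_mem _ hp, pow_two (∑ k ∈ K, _), Finset.sum_mul_sum,
          Finset.sum_product, mul_assoc]

/-- The weight `⟨τ - φ(k)⟩^{-2/3}`, up to constants. -/
def rho (α μ : ℝ) (k : ℤ) (τ : ℝ) : ℝ≥0∞ := ENNReal.ofReal (wt (τ - phase α μ k))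

theorem measurable_rho (α μ : ℝ) (k : ℤ) : Measurable (rho α μ k) := by
  have := continuous_wt
  unfold rho
  fun_prop

theorem rho_ne_zero (α μ : ℝ) (k : ℤ) (τ : ℝ) : rho α μ k τ ≠ 0 := by
  simpa [rho] using wt_pos _

theorem rho_ne_top (α μ : ℝ) (k : ℤ) (τ : ℝ) : rho α μ k τ ≠ ⊤ := ENNReal.ofReal_ne_top

theorem rho_neg (α μ : ℝ) (k : ℤ) (τ : ℝ) : rho α μ (-k) (-τ) = rho α μ k τ := by
  rw [rho, rho, phase_neg, ← wt_neg]
  congr 2; ring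

/-- The weighted `L²` norm on the Fourier side. -/
def wnorm (α μ : ℝ) (K : Finset ℤ) (G : ℤ → ℝ → ℂ) : ℝ≥0∞ :=
  (∑ k ∈ K, ∫⁻ τ, (rho α μ k τ)⁻¹ * ‖G k τ‖ₑ ^ 2) ^ (1 / 2 : ℝ)

theorem lintegral_rho_mul_rho_le (α μ τ : ℝ) (k l : ℤ) :
    ∫⁻ σ, rho α μ k σ * rho α μ l (τ - σ) ≤
      ENNReal.ofReal (48 * (max 1 |τ - phase α μ k - phase α μ l|) ^ (-(1 / 3) : ℝ)) := by
  refine le_trans (le_of_eq ?_) (lintegral_wt_mul_wt_le (τ - phase α μ k - phase α μ l))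
  rw [← lintegral_sub_right_eq_self (fun σ => ENNReal.ofReal (wt σ) *
    ENNReal.ofReal (wt (τ - phase α μ k - phase α μ l - σ))) (phase α μ k)]
  refine lintegral_congr fun σ => ?_
  rw [rho, rho]
  congr 3; ring

theorem eLpNorm_four_pow {X : Type*} [MeasurableSpace X] {m : Measure X} (f : X → ℂ) :
    eLpNorm f 4 m ^ 4 = ∫⁻ x, ‖f x‖ₑ ^ 4 ∂m := by
  rw [eLpNorm_eq_lintegral_rpow_enorm_toReal (by norm_num) (by norm_num), ← ENNReal.rpow_natCast,
    ← ENNReal.rpow_mul]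
  norm_num

/-- The common sign bounds the pair sums independently of `K`. Without it, at `n = 0` and `τ = 0`
every pair `(k, -k)` would contribute 1 to the counting sum. -/
theorem eLpNorm_trig_le_of_sign {α : ℝ} (hα : 0 < α) :
    ∃ C : ℝ≥0, ∀ (μ : ℝ) (K : Finset ℤ) (G : ℤ → ℝ → ℂ), (∀ k, Integrable (G k)) →
      (∀ k, Measurable (G k)) → (∀ k, ∃ C : ℝ, ∀ τ, ‖G k τ‖ ≤ C) →
      ((∀ k ∈ K, 0 ≤ k) ∨ (∀ k ∈ K, k ≤ 0)) →
      eLpNorm (trig K G) 4 volume ≤ C * wnorm α μ K G := by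
  obtain ⟨B, hB, h⟩ := sum_pairs_le hα
  refine ⟨Real.toNNReal (((2 * Real.pi) ^ 2 * (48 * B)) ^ (1 / 4 : ℝ)),
    fun μ K G hG hGm hGb hK => ?_⟩
  have key := lintegral_trig_pow_four_le K hG hGm hGb (measurable_rho α μ) (rho_ne_zero α μ)
    (rho_ne_top α μ) (B := ENNReal.ofReal (48 * B)) (by
      intro n τ
      refine (Finset.sum_le_sum fun p _ => lintegral_rho_mul_rho_le α μ τ p.1 p.2).trans ?_
      rw [← ENNReal.ofReal_sum_of_nonneg fun p _ => by positivity, ← Finset.mul_sum]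
      exact ENNReal.ofReal_le_ofReal (mul_le_mul_of_nonneg_left (h μ τ K hK n) (by norm_num)))
  rw [← eLpNorm_four_pow] at key
  refine (ENNReal.pow_le_pow_left_iff (n := 4) (by norm_num)).1 (key.trans_eq ?_)
  rw [mul_pow, wnorm, ← ENNReal.rpow_natCast (_ ^ (1 / 2 : ℝ)), ← ENNReal.rpow_mul]
  congr 1
  · change _ = ENNReal.ofReal _ ^ 4
    rw [← ENNReal.ofReal_pow Real.two_pi_pos.le, ← ENNReal.ofReal_mul (by positivity),
      ← ENNReal.ofReal_pow (by positivity), ← Real.rpow_natCast (_ ^ (1 / 4 : ℝ)),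
      ← Real.rpow_mul (by positivity)]
    norm_num
  · norm_num

theorem wnorm_mono (α μ : ℝ) {K L : Finset ℤ} (h : K ⊆ L) (G : ℤ → ℝ → ℂ) :
    wnorm α μ K G ≤ wnorm α μ L G :=
  ENNReal.rpow_le_rpow (Finset.sum_le_sum_of_subset h) (by norm_num)

/-- The `L⁴` Strichartz estimate for trigonometric sums. -/
theorem eLpNorm_trig_le {α : ℝ} (hα : 0 < α) :
    ∃ C : ℝ≥0, ∀ (μ : ℝ) (K : Finset ℤ) (G : ℤ → ℝ → ℂ), (∀ k, Integrable (G k)) →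
      (∀ k, Measurable (G k)) → (∀ k, ∃ C : ℝ, ∀ τ, ‖G k τ‖ ≤ C) →
      eLpNorm (trig K G) 4 volume ≤ C * wnorm α μ K G := by
  obtain ⟨C, hC⟩ := eLpNorm_trig_le_of_sign hα
  refine ⟨2 * C, fun μ K G hG hGm hGb => ?_⟩
  -- The two sign classes are estimated separately, at the cost of a factor 2.
  have hsplit : trig K G = trig (K.filter (0 ≤ ·)) G + trig (K.filter (¬ 0 ≤ ·)) G := by
    ext z
    simp only [trig, Pi.add_apply]
    rw [Finset.sum_filter_add_sum_filter_not]
  rw [hsplit]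
  refine (eLpNorm_add_le (continuous_trig _ hG).aestronglyMeasurable
    (continuous_trig _ hG).aestronglyMeasurable (by norm_num)).trans ?_
  have h1 := hC μ (K.filter (0 ≤ ·)) G hG hGm hGb
    (Or.inl fun k hk => (Finset.mem_filter.1 hk).2)
  have h2 := hC μ (K.filter (¬ 0 ≤ ·)) G hG hGm hGb
    (Or.inr fun k hk => (not_le.1 (Finset.mem_filter.1 hk).2).le)
  calc _ ≤ C * wnorm α μ K G + C * wnorm α μ K G := by
        refine add_le_add (h1.trans ?_) (h2.trans ?_) <;>
        · gcongr
          exact wnorm_mono α μ (Finset.filter_subset _ _) G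
    _ = _ := by push_cast; ring

/-! ### The dual estimate. -/

theorem norm_exp_neg_I_mul (t τ : ℝ) : ‖Complex.exp (-(Complex.I * t * τ))‖ = 1 := by
  rw [show -(Complex.I * t * τ) = ((-(t * τ) : ℝ) : ℂ) * Complex.I by push_cast; ring,
    Complex.norm_exp_ofReal_mul_I]

theorem norm_fourier_apply (k : ℤ) (x : AddCircle (2 * Real.pi)) : ‖fourier k x‖ = 1 := by
  rw [fourier_apply, Circle.norm_coe]

theorem continuous_char (k : ℤ) (τ : ℝ) :
    Continuous fun z : Cyl => fourier k z.1 * Complex.exp (-(Complex.I * z.2 * τ)) := by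
  fun_prop

theorem integrable_mul_char {f : Cyl → ℂ} (hf : Integrable f) (k : ℤ) (τ : ℝ) :
    Integrable fun z : Cyl => f z * fourier k z.1 * Complex.exp (-(Complex.I * z.2 * τ)) := by
  simp_rw [mul_assoc (f _)]
  refine hf.mul_bdd (c := 1) (continuous_char k τ).aestronglyMeasurable
    (ae_of_all _ fun z => ?_)
  rw [norm_mul, norm_fourier_apply, norm_exp_neg_I_mul, one_mul]

theorem fourierST_eq {f : Cyl → ℂ} (hf : Integrable f) (k : ℤ) (τ : ℝ) :
    fourierST f k τ = (1 / (2 * Real.pi) : ℂ) *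
      ∫ z : Cyl, f z * fourier (-k) z.1 * Complex.exp (-(Complex.I * z.2 * τ)) := by
  rw [fourierST, Measure.volume_eq_prod, integral_prod_symm _ (integrable_mul_char hf (-k) τ)]

theorem continuous_fourierST {f : Cyl → ℂ} (hf : Integrable f) (k : ℤ) :
    Continuous (fourierST f k) := by
  have : fourierST f k = fun τ : ℝ => (1 / (2 * Real.pi) : ℂ) *
      ∫ z : Cyl, f z * fourier (-k) z.1 * Complex.exp (-(Complex.I * z.2 * τ)) :=
    funext (fourierST_eq hf k)
  rw [this]
  refine continuous_const.mul ?_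
  refine continuous_of_dominated (bound := fun z => ‖f z‖)
    (fun τ => (integrable_mul_char hf _ τ).aestronglyMeasurable) (fun τ => ae_of_all _ fun z => ?_)
    hf.norm (ae_of_all _ fun z => by fun_prop)
  rw [norm_mul, norm_mul, norm_fourier_apply, norm_exp_neg_I_mul, mul_one, mul_one]

/-- Fubini's theorem for the pairing of a function with a trigonometric sum. -/
theorem integral_mul_trig {f : Cyl → ℂ} (hf : Integrable f) (K : Finset ℤ) {G : ℤ → ℝ → ℂ}
    (hG : ∀ k, Integrable (G k)) :
    ∫ z, f z * trig K G z =
      (2 * Real.pi : ℂ) * ∑ k ∈ K, ∫ τ, G k τ * fourierST f (-k) (-τ) := by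
  have hFi : ∀ k, Integrable (fun p : Cyl × ℝ => (f p.1 * G k p.2) *
      (fourier k p.1.1 * Complex.exp (Complex.I * p.1.2 * p.2)))
      ((volume : Measure Cyl).prod volume) := by
    intro k
    refine (hf.mul_prod (hG k)).mul_bdd (c := 1) (by fun_prop) (ae_of_all _ fun p => ?_)
    rw [norm_mul, norm_fourier_apply, one_mul, mul_assoc, ← Complex.ofReal_mul, mul_comm,
      Complex.norm_exp_ofReal_mul_I]
  have h1 : ∀ (k : ℤ) (z : Cyl), f z * (fourier k z.1 * expT (G k) z.2) =
      ∫ τ, (f z * G k τ) * (fourier k z.1 * Complex.exp (Complex.I * z.2 * τ)) := by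
    intro k z
    rw [expT, ← integral_const_mul, ← integral_const_mul]
    congr with τ
    ring
  have h2 : ∀ k, ∫ z : Cyl, f z * (fourier k z.1 * expT (G k) z.2) =
      (2 * Real.pi : ℂ) * ∫ τ, G k τ * fourierST f (-k) (-τ) := by
    intro k
    simp_rw [h1]
    rw [integral_integral_swap (hFi k), ← integral_const_mul]
    congr with τ
    -- The pairing is bilinear, without conjugation, so the mode `(k, τ)` sees the transform of `f`
    -- at `(-k, -τ)`.
    rw [fourierST_eq hf, neg_neg]
    have hpi : (Real.pi : ℂ) ≠ 0 := by exact_mod_cast Real.pi_ne_zero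
    have e : ∀ I : ℂ, (2 * Real.pi : ℂ) * (G k τ * ((1 / (2 * Real.pi) : ℂ) * I)) = G k τ * I := by
      intro I; field_simp
    rw [e, ← integral_const_mul]
    congr with z
    push_cast
    rw [mul_neg, neg_neg]
    ring
  simp only [trig, Finset.mul_sum]
  rw [integral_finsetSum]
  · exact Finset.sum_congr rfl fun k _ => h2 k
  · intro k _
    simp_rw [h1]
    exact (hFi k).integral_prod_left

instance holderConjugate_four_thirds_four : ENNReal.HolderConjugate (4 / 3) 4 where
  inv_add_inv_eq_inv := by
    rw [ENNReal.inv_div (Or.inr (by norm_num)) (Or.inr (by norm_num)), inv_one, ← one_div (4 : ℝ≥0∞),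
      ← ENNReal.add_div]
    norm_num
    exact ENNReal.div_self (by norm_num) (by norm_num)

theorem enorm_integral_mul_le {f g : Cyl → ℂ} (hf : AEStronglyMeasurable f volume)
    (hg : AEStronglyMeasurable g volume) :
    ‖∫ z, f z * g z‖ₑ ≤ eLpNorm f (4 / 3) volume * eLpNorm g 4 volume := by
  refine (enorm_integral_le_lintegral_enorm _).trans ?_
  have := eLpNorm_smul_le_mul_eLpNorm (p := 4 / 3) (q := 4) (r := 1) hg hf
  rw [eLpNorm_one_eq_lintegral_enorm] at this
  exact this

/-- The division by `S^{1/2}` requires `S` finite; this is why the dual estimate is first proved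
with truncated `k` and `τ`. -/
theorem le_of_le_mul_rpow_half {S D : ℝ≥0∞} (hS : S ≠ ⊤) (h : S ≤ D * S ^ (1 / 2 : ℝ)) :
    S ^ (1 / 2 : ℝ) ≤ D := by
  rcases eq_or_ne S 0 with rfl | h0
  · simp
  have h1 : S ^ (1 / 2 : ℝ) * S ^ (1 / 2 : ℝ) = S := by
    rw [← ENNReal.rpow_add _ _ h0 hS]; norm_num
  have hp0 : S ^ (1 / 2 : ℝ) ≠ 0 := by
    simp [ENNReal.rpow_eq_zero_iff, h0]
  have hpt : S ^ (1 / 2 : ℝ) ≠ ⊤ := ENNReal.rpow_ne_top_of_nonneg (by norm_num) hS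
  have h2 := h1.le.trans h
  exact (ENNReal.mul_le_mul_iff_left hp0 hpt).1 h2

theorem ofReal_sq_norm (z : ℂ) : ENNReal.ofReal (‖z‖ ^ 2) = ‖z‖ₑ ^ 2 := by
  rw [ENNReal.ofReal_pow (norm_nonneg _), ofReal_norm]

/-- The truncated dual estimate. -/
theorem truncated_dual_estimate {α : ℝ} (hα : 0 < α) :
    ∃ C : ℝ≥0, ∀ (μ : ℝ) (f : Cyl → ℂ), Integrable f → ∀ (K : Finset ℤ) (N : ℕ),
      (∑ k ∈ K, ∫⁻ τ in Set.Icc (-(N : ℝ)) N,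
        rho α μ k τ * ‖fourierST f (-k) (-τ)‖ₑ ^ 2) ^ (1 / 2 : ℝ) ≤
        C * eLpNorm f (4 / 3) volume := by
  obtain ⟨C, hC⟩ := eLpNorm_trig_le hα
  refine ⟨C, fun μ f hf K N => ?_⟩
  set I : Set ℝ := Set.Icc (-(N : ℝ)) N with hI
  have hIm : MeasurableSet I := measurableSet_Icc
  set F : ℤ → ℝ → ℂ := fun k τ => fourierST f (-k) (-τ) with hF
  have hFc : ∀ k, Continuous (F k) := fun k => (continuous_fourierST hf (-k)).comp continuous_neg
  have hwc : ∀ k, Continuous fun τ => wt (τ - phase α μ k) := fun k =>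
    continuous_wt.comp (continuous_sub_right _)
  -- The extremal choice: pairing `f` with `trig K G` gives `2π S`, while the weighted norm of `G`
  -- is exactly `S^{1/2}`. The cutoff to `I` makes `G` bounded and integrable.
  set G : ℤ → ℝ → ℂ := fun k =>
    I.indicator fun τ => (wt (τ - phase α μ k) : ℂ) * (starRingEnd ℂ) (F k τ) with hG
  have hGc : ∀ k, Continuous fun τ => (wt (τ - phase α μ k) : ℂ) * (starRingEnd ℂ) (F k τ) := by
    intro k; have := hFc k; have := hwc k; fun_prop
  have hGm : ∀ k, Measurable (G k) := fun k => (hGc k).measurable.indicator hIm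
  have hGi : ∀ k, Integrable (G k) := fun k =>
    (integrable_indicator_iff hIm).2 ((hGc k).integrableOn_Icc)
  have hGb : ∀ k, ∃ c : ℝ, ∀ τ, ‖G k τ‖ ≤ c := by
    intro k
    obtain ⟨c, hc⟩ := isCompact_Icc.exists_bound_of_continuousOn (s := I) (hGc k).continuousOn
    refine ⟨max c 0, fun τ => ?_⟩
    by_cases h : τ ∈ I
    · simp only [hG, Set.indicator_of_mem h]; exact (hc τ h).trans (le_max_left _ _)
    · simp only [hG, Set.indicator_of_notMem h, norm_zero]; exact le_max_right _ _
  set S : ℝ≥0∞ := ∑ k ∈ K, ∫⁻ τ in I, rho α μ k τ * ‖F k τ‖ₑ ^ 2 with hS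
  have hrc : ∀ k, Continuous fun τ => wt (τ - phase α μ k) * ‖F k τ‖ ^ 2 := by
    intro k; have := hFc k; have := hwc k; fun_prop
  have hr0 : ∀ k τ, 0 ≤ wt (τ - phase α μ k) * ‖F k τ‖ ^ 2 := fun k τ =>
    mul_nonneg (wt_pos _).le (by positivity)
  have hSk : ∀ k, ∫⁻ τ in I, rho α μ k τ * ‖F k τ‖ₑ ^ 2 =
      ENNReal.ofReal (∫ τ in I, wt (τ - phase α μ k) * ‖F k τ‖ ^ 2) := by
    intro k
    rw [ofReal_integral_eq_lintegral_ofReal (hrc k).integrableOn_Icc (ae_of_all _ (hr0 k))]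
    refine lintegral_congr fun τ => ?_
    rw [ENNReal.ofReal_mul (wt_pos _).le, ofReal_sq_norm, rho]
  have hS' : S = ENNReal.ofReal (∑ k ∈ K, ∫ τ in I, wt (τ - phase α μ k) * ‖F k τ‖ ^ 2) := by
    rw [ENNReal.ofReal_sum_of_nonneg fun k _ => integral_nonneg (hr0 k), hS]
    exact Finset.sum_congr rfl fun k _ => hSk k
  have hpair : ∫ z, f z * trig K G z = ((2 * Real.pi * ∑ k ∈ K, ∫ τ in I,
      wt (τ - phase α μ k) * ‖F k τ‖ ^ 2 : ℝ) : ℂ) := by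
    rw [integral_mul_trig hf K hGi]
    push_cast
    congr 1
    refine Finset.sum_congr rfl fun k _ => ?_
    rw [← integral_complex_ofReal, ← integral_indicator hIm]
    congr with τ
    by_cases h : τ ∈ I
    · simp only [hG, Set.indicator_of_mem h]
      rw [mul_assoc, mul_comm ((starRingEnd ℂ) _), Complex.mul_conj, Complex.normSq_eq_norm_sq]
      push_cast; rfl
    · simp only [hG, Set.indicator_of_notMem h, zero_mul]
  have hw : wnorm α μ K G = S ^ (1 / 2 : ℝ) := by
    rw [wnorm, hS]
    congr 1
    refine Finset.sum_congr rfl fun k _ => ?_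
    rw [← lintegral_indicator hIm]
    refine lintegral_congr fun τ => ?_
    by_cases h : τ ∈ I
    · simp only [hG, Set.indicator_of_mem h]
      rw [enorm_mul, RCLike.enorm_conj, mul_pow]
      have : ‖(wt (τ - phase α μ k) : ℂ)‖ₑ = rho α μ k τ := by
        rw [rho, ← ofReal_norm, Complex.norm_of_nonneg (wt_pos _).le]
      rw [this, pow_two (rho _ _ _ _), ← mul_assoc, ← mul_assoc,
        ENNReal.inv_mul_cancel (rho_ne_zero _ _ _ _) (rho_ne_top _ _ _ _), one_mul]
    · simp [hG, Set.indicator_of_notMem h]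
  refine le_of_le_mul_rpow_half (by rw [hS']; exact ENNReal.ofReal_ne_top) ?_
  calc S ≤ ENNReal.ofReal (2 * Real.pi) * S := by
        refine le_mul_of_one_le_left (zero_le) ?_
        rw [ENNReal.one_le_ofReal]
        linarith [Real.pi_gt_three]
    _ = ‖∫ z, f z * trig K G z‖ₑ := by
        rw [hpair, hS', ← ENNReal.ofReal_mul Real.two_pi_pos.le, ← ofReal_norm,
          Complex.norm_of_nonneg]
        exact mul_nonneg Real.two_pi_pos.le
          (Finset.sum_nonneg fun k _ => integral_nonneg (hr0 k))
    _ ≤ eLpNorm f (4 / 3) volume * eLpNorm (trig K G) 4 volume :=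
        enorm_integral_mul_le hf.aestronglyMeasurable
          (continuous_trig K hGi).aestronglyMeasurable
    _ ≤ eLpNorm f (4 / 3) volume * (C * wnorm α μ K G) := by
        gcongr; exact hC μ K G hGi hGm hGb
    _ = _ := by rw [hw]; ring

/-- Undoes the reflection introduced by the bilinear pairing. The weights qualify because the phase
is odd (`rho_neg`). -/
theorem tsum_neg_neg {w : ℤ → ℝ → ℝ≥0∞} (hw : ∀ k τ, w (-k) (-τ) = w k τ) (F : ℤ → ℝ → ℂ) :
    ∑' k : ℤ, ∫⁻ τ, w k τ * ‖F (-k) (-τ)‖ₑ ^ 2 = ∑' k : ℤ, ∫⁻ τ, w k τ * ‖F k τ‖ₑ ^ 2 := by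
  rw [← (Equiv.neg ℤ).tsum_eq]
  refine tsum_congr fun k => ?_
  rw [← lintegral_neg_eq_self]
  refine lintegral_congr fun τ => ?_
  simp [hw]

/-- The dual estimate: the `L^{4/3}` norm controls the `X_{0,-1/3}` norm. -/
theorem dual_estimate {α : ℝ} (hα : 0 < α) :
    ∃ C : ℝ≥0, ∀ (μ : ℝ) (f : Cyl → ℂ), Integrable f →
      (∑' k : ℤ, ∫⁻ τ, rho α μ k τ * ‖fourierST f k τ‖ₑ ^ 2) ^ (1 / 2 : ℝ) ≤
        C * eLpNorm f (4 / 3) volume := by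
  obtain ⟨C, hC⟩ := truncated_dual_estimate hα
  refine ⟨C, fun μ f hf => ?_⟩
  rw [← tsum_neg_neg (rho_neg α μ)]
  set D : ℝ≥0∞ := C * eLpNorm f (4 / 3) volume with hD
  have hsq : ∀ x : ℝ≥0∞, x ^ (1 / 2 : ℝ) ≤ D ↔ x ≤ D ^ (2 : ℝ) := by
    intro x
    rw [one_div, ENNReal.rpow_inv_le_iff (by norm_num)]
  rw [hsq, ENNReal.tsum_eq_iSup_sum]
  refine iSup_le fun K => ?_
  have hm : ∀ k, Measurable fun τ => rho α μ k τ * ‖fourierST f (-k) (-τ)‖ₑ ^ 2 := by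
    intro k
    have h1 := measurable_rho α μ k
    have h2 := ((continuous_fourierST hf (-k)).comp continuous_neg).measurable.enorm.pow_const 2
    exact h1.mul h2
  have hcov : AECover (volume : Measure ℝ) atTop fun N : ℕ => Set.Icc (-(N : ℝ)) N :=
    aecover_Icc (tendsto_neg_atTop_atBot.comp tendsto_natCast_atTop_atTop)
      tendsto_natCast_atTop_atTop
  -- The bound is uniform in `N` and `K`, so the truncation in `τ` is removed by exhaustion and that
  -- in `k` by a supremum.
  refine le_of_tendsto' (tendsto_finsetSum K fun k _ =>
    hcov.lintegral_tendsto_of_countably_generated (hm k).aemeasurable) fun N => ?_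
  rw [← hsq]
  exact hC μ f hf K N

/-! ### Schwartz functions and `L^{4/3}` functions as distributions. -/

theorem continuous_of_continuous_lift {v : Cyl → ℂ} (h : Continuous (lift v)) : Continuous v := by
  have hq : IsOpenQuotientMap
      (Prod.map (QuotientAddGroup.mk : ℝ → AddCircle (2 * Real.pi)) (id : ℝ → ℝ)) :=
    QuotientAddGroup.isOpenQuotientMap_mk.prodMap IsOpenQuotientMap.id
  exact hq.continuous_comp_iff.1 h

theorem continuous_schwartz (v : Schwartz) : Continuous (v : Cyl → ℂ) :=
  continuous_of_continuous_lift v.2.1.continuous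

/-- Adding the bounds for `‖v‖` and `t² ‖v‖` gives a decay that lies in every `L^p`, `1 ≤ p < ∞`,
since the circle is compact. -/
theorem norm_le_of_seminormLE {v : Cyl → ℂ} {B : ℝ} (h0 : SeminormLE v 0 0 B)
    (h2 : SeminormLE v 2 0 B) (z : Cyl) : ‖v z‖ ≤ 2 * B * (1 + z.2 ^ 2)⁻¹ := by
  obtain ⟨x, t⟩ := z
  obtain ⟨x, rfl⟩ := QuotientAddGroup.mk_surjective x
  have e0 := h0 (x, t)
  have e2 := h2 (x, t)
  rw [norm_iteratedFDeriv_zero] at e0 e2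
  rw [sq_abs] at e2
  rw [pow_zero, one_mul] at e0
  change ‖lift v (x, t)‖ ≤ _
  rw [← div_eq_mul_inv, le_div_iff₀ (by positivity)]
  simp only at e2 ⊢
  nlinarith

theorem memLp_decay {p : ℝ≥0∞} (hp : 1 ≤ p) (hpt : p ≠ ⊤) :
    MemLp (fun z : Cyl => (1 + z.2 ^ 2)⁻¹) p volume := by
  have hc : Continuous fun z : Cyl => (1 + z.2 ^ 2)⁻¹ := by
    refine Continuous.inv₀ (by fun_prop) fun z => by positivity
  have hi : Integrable (fun z : Cyl => (1 + z.2 ^ 2)⁻¹) volume :=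
    integrable_inv_one_add_sq.comp_snd (volume : Measure (AddCircle (2 * Real.pi)))
  have hp0 : p ≠ 0 := (zero_lt_one.trans_le hp).ne'
  refine (integrable_norm_rpow_iff hc.aestronglyMeasurable hp0 hpt).1 ?_
  refine hi.mono' (hc.norm.measurable.pow_const _).aestronglyMeasurable (ae_of_all _ fun z => ?_)
  have h1 : (0 : ℝ) < (1 + z.2 ^ 2)⁻¹ := by positivity
  have h2 : (1 + z.2 ^ 2)⁻¹ ≤ (1 : ℝ) := inv_le_one_of_one_le₀ (by nlinarith [sq_nonneg z.2])
  rw [Real.norm_of_nonneg (by positivity), Real.norm_of_nonneg h1.le]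
  calc _ ≤ (1 + z.2 ^ 2)⁻¹ ^ (1 : ℝ) := by
        refine Real.rpow_le_rpow_of_exponent_ge h1 h2 ?_
        rw [← ENNReal.toReal_one]
        exact (ENNReal.toReal_le_toReal ENNReal.one_ne_top hpt).2 hp
    _ = _ := Real.rpow_one _

theorem memLp_schwartz (v : Schwartz) {p : ℝ≥0∞} (hp : 1 ≤ p) (hpt : p ≠ ⊤) :
    MemLp (v : Cyl → ℂ) p volume := by
  obtain ⟨B0, h0⟩ := v.2.2 0 0
  obtain ⟨B2, h2⟩ := v.2.2 2 0
  refine ((memLp_decay hp hpt).const_mul (2 * max B0 B2)).mono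
    (continuous_schwartz v).aestronglyMeasurable (ae_of_all _ fun z => ?_)
  exact (norm_le_of_seminormLE (fun p => (h0 p).trans (le_max_left _ _))
    (fun p => (h2 p).trans (le_max_right _ _)) z).trans (le_abs_self _)

theorem integrable_schwartz (v : Schwartz) : Integrable (v : Cyl → ℂ) :=
  memLp_one_iff_integrable.1 (memLp_schwartz v le_rfl ENNReal.one_ne_top)

theorem one_le_four_thirds : (1 : ℝ≥0∞) ≤ 4 / 3 := by
  rw [ENNReal.le_div_iff_mul_le (Or.inl (by norm_num)) (Or.inl (by norm_num))]
  norm_num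

theorem four_thirds_ne_top : (4 / 3 : ℝ≥0∞) ≠ ⊤ :=
  ENNReal.div_ne_top (by norm_num) (by norm_num)

theorem integrable_mul_schwartz {f : Cyl → ℂ} (hf : MemLp f (4 / 3) volume) (ψ : Schwartz) :
    Integrable fun z => f z * (ψ : Cyl → ℂ) z :=
  hf.integrable_mul (memLp_schwartz ψ (p := 4) (by norm_num) (by norm_num))

/-- A function in `L^{4/3}` is a tempered distribution. -/
def ofMemLp (f : Cyl → ℂ) (hf : MemLp f (4 / 3) volume) : TemperedDist where
  toLinearMap :=
    { toFun := fun ψ => ∫ z, f z * (ψ : Cyl → ℂ) z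
      map_add' := by
        intro ψ χ
        rw [← integral_add (integrable_mul_schwartz hf ψ) (integrable_mul_schwartz hf χ)]
        congr with z
        simp [mul_add]
      map_smul' := by
        intro c ψ
        simp only [RingHom.id_apply, smul_eq_mul]
        rw [← integral_const_mul]
        congr with z
        simp [mul_left_comm] }
  bounded' := by
    set D : ℝ≥0∞ := eLpNorm f (4 / 3) volume *
      (2 * eLpNorm (fun z : Cyl => (1 + z.2 ^ 2)⁻¹) 4 volume) with hD
    have hDt : D ≠ ⊤ := ENNReal.mul_ne_top hf.eLpNorm_ne_top
      (ENNReal.mul_ne_top (by norm_num) (memLp_decay (by norm_num) (by norm_num)).eLpNorm_ne_top)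
    -- Hölder reduces to `‖ψ‖_{L⁴}`, which the seminorms `(0, 0)` and `(2, 0)` control; hence the
    -- order 2.
    refine ⟨2, D.toReal, fun ψ B hB => ?_⟩
    have hB0 : 0 ≤ B := (by positivity : (0 : ℝ) ≤ _).trans (hB 0 (by norm_num) 0 (by norm_num) 0)
    have h1 : eLpNorm (ψ : Cyl → ℂ) 4 volume ≤
        ENNReal.ofReal (2 * B) * eLpNorm (fun z : Cyl => (1 + z.2 ^ 2)⁻¹) 4 volume := by
      refine eLpNorm_le_mul_eLpNorm_of_ae_le_mul (ae_of_all _ fun z => ?_) 4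
      rw [Real.norm_of_nonneg (by positivity)]
      exact norm_le_of_seminormLE (hB 0 (by norm_num) 0 (by norm_num))
        (hB 2 le_rfl 0 (by norm_num)) z
    have h2 : ‖∫ z, f z * (ψ : Cyl → ℂ) z‖ₑ ≤ D * ENNReal.ofReal B := by
      refine (enorm_integral_mul_le hf.aestronglyMeasurable
        (continuous_schwartz ψ).aestronglyMeasurable).trans ?_
      calc _ ≤ eLpNorm f (4 / 3) volume * (ENNReal.ofReal (2 * B) *
            eLpNorm (fun z : Cyl => (1 + z.2 ^ 2)⁻¹) 4 volume) := by gcongr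
        _ = _ := by
          rw [ENNReal.ofReal_mul (by norm_num), hD]
          norm_num
          ring
    have h3 := ENNReal.toReal_mono (ENNReal.mul_ne_top hDt ENNReal.ofReal_ne_top) h2
    rw [toReal_enorm, ENNReal.toReal_mul, ENNReal.toReal_ofReal hB0] at h3
    exact h3

theorem ofMemLp_isFunction (f : Cyl → ℂ) (hf : MemLp f (4 / 3) volume) :
    (ofMemLp f hf).IsFunction f := fun ψ =>
  ⟨integrable_mul_schwartz hf ψ, rfl⟩

/-! ### Density of smooth trigonometric sums. -/

/-- The function `∑_{k ∈ K} e^{ikx} h_k(t)`. -/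
def tens (K : Finset ℤ) (h : ℤ → ℝ → ℂ) (z : Cyl) : ℂ := ∑ k ∈ K, fourier k z.1 * h k z.2

/-- A smooth function on the cylinder supported in a strip `|t| ≤ R` is a Schwartz function. -/
theorem mem_schwartz_of_support {v : Cyl → ℂ} (hv : ContDiff ℝ ∞ (lift v)) {R : ℝ}
    (hR : ∀ z : Cyl, R < |z.2| → v z = 0) : v ∈ Schwartz := by
  refine ⟨hv, fun m n => ?_⟩
  set Φ : ℝ × ℝ → ℝ := fun p => |p.2| ^ m * ‖iteratedFDeriv ℝ n (lift v) p‖ with hΦ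
  have hcont : Continuous Φ := by
    have := hv.continuous_iteratedFDeriv (m := n) (by exact_mod_cast le_top)
    fun_prop
  obtain ⟨B, hB⟩ := ((isCompact_Icc (a := (0 : ℝ)) (b := 2 * Real.pi)).prod
    (isCompact_Icc (a := -R) (b := R))).exists_bound_of_continuousOn hcont.continuousOn
  -- Periodicity in `x` extends the bound from the compact set `[0, 2π] × [-R, R]` to the whole
  -- strip.
  have hper : ∀ t, Function.Periodic (fun x => Φ (x, t)) (2 * Real.pi) := by
    intro t x
    have e : (fun p : ℝ × ℝ => lift v (p + (2 * Real.pi, 0))) = lift v := by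
      ext p
      simp only [lift, Prod.fst_add, Prod.snd_add, add_zero, AddCircle.coe_add_period]
    have h := iteratedFDeriv_comp_add_right (𝕜 := ℝ) (f := lift v) n (2 * Real.pi, (0 : ℝ)) (x, t)
    rw [e] at h
    simp only [hΦ]
    rw [h]
    simp
  refine ⟨max B 0, fun p => ?_⟩
  change Φ p ≤ _
  obtain ⟨x, t⟩ := p
  by_cases ht : R < |t|
  · have h0 : lift v =ᶠ[𝓝 (x, t)] fun _ => 0 := by
      have ho : IsOpen {p : ℝ × ℝ | R < |p.2|} := isOpen_lt continuous_const (by fun_prop)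
      filter_upwards [ho.mem_nhds ht] with p hp
      exact hR _ hp
    have : Φ (x, t) = 0 := by
      simp only [hΦ]
      rw [(h0.iteratedFDeriv ℝ n).eq_of_nhds]
      have : iteratedFDeriv ℝ n (fun _ : ℝ × ℝ => (0 : ℂ)) (x, t) = 0 := by
        simp
      rw [this]; simp
    rw [this]; exact le_max_right _ _
  · push Not at ht
    obtain ⟨y, hy, hxy⟩ := (hper t).exists_mem_Ico₀ Real.two_pi_pos x
    rw [hxy]
    refine (le_abs_self _).trans ((hB (y, t) ⟨⟨hy.1, hy.2.le⟩, abs_le.1 ht⟩).trans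
      (le_max_left _ _))

theorem tens_mem_schwartz (K : Finset ℤ) {h : ℤ → ℝ → ℂ} (hs : ∀ k, ContDiff ℝ ∞ (h k))
    (hc : ∀ k, HasCompactSupport (h k)) : tens K h ∈ Schwartz := by
  have e : tens K h = ∑ k ∈ K, fun z : Cyl => fourier k z.1 * h k z.2 := by
    ext z; simp [tens]
  rw [e]
  refine Submodule.sum_mem _ fun k _ => ?_
  obtain ⟨R, hR⟩ := (hc k).isBounded.subset_closedBall 0
  refine mem_schwartz_of_support (R := R) ?_ fun z hz => ?_
  · have : lift (fun z : Cyl => fourier k z.1 * h k z.2) = fun p : ℝ × ℝ =>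
        Complex.exp (2 * Real.pi * Complex.I * k * (p.1 : ℂ) / ((2 * Real.pi : ℝ) : ℂ)) * h k p.2 := by
      ext p
      simp only [lift, fourier_coe_apply]
    rw [this]
    have h1 : ContDiff ℝ ∞ fun p : ℝ × ℝ => (p.1 : ℂ) := Complex.ofRealCLM.contDiff.comp contDiff_fst
    have h2 : ContDiff ℝ ∞ fun p : ℝ × ℝ => h k p.2 := (hs k).comp contDiff_snd
    exact ((contDiff_const.mul h1).div_const _).cexp.mul h2
  · have : h k z.2 = 0 := by
      by_contra hne
      have := hR (subset_tsupport _ hne)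
      rw [mem_closedBall_zero_iff, Real.norm_eq_abs] at this
      linarith
    simp [this]

/-- The product `e^{ikx} h(t)` on a compact strip. -/
def stripMode (R : ℝ) (k : ℤ) (h : C(ℝ, ℂ)) :
    C(AddCircle (2 * Real.pi) × Set.Icc (-R) R, ℂ) where
  toFun z := fourier k z.1 * h z.2
  continuous_toFun := by fun_prop

/-- The products `e^{ikx} h(t)` with `h` smooth, on a compact strip. -/
def stripModes (R : ℝ) : Set C(AddCircle (2 * Real.pi) × Set.Icc (-R) R, ℂ) :=
  {F | ∃ (k : ℤ) (h : C(ℝ, ℂ)), ContDiff ℝ ∞ h ∧ F = stripMode R k h}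

/-- The star algebra generated by the products `e^{ikx} h(t)` on a compact strip. -/
def stripAlgebra (R : ℝ) :
    StarSubalgebra ℂ C(AddCircle (2 * Real.pi) × Set.Icc (-R) R, ℂ) where
  toSubalgebra := Algebra.adjoin ℂ (stripModes R)
  star_mem' := by
    change Algebra.adjoin ℂ (stripModes R) ≤ star (Algebra.adjoin ℂ (stripModes R))
    refine Algebra.adjoin_le ?_
    rintro - ⟨k, h, hh, rfl⟩
    refine Algebra.subset_adjoin ⟨-k, star h, Complex.conjCLE.contDiff.comp hh, ?_⟩
    ext z
    simp [stripMode]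

/-- The function `t` separates points at different times, and `e^{ix}` separates points of the
circle. -/
theorem stripAlgebra_separatesPoints (R : ℝ) : (stripAlgebra R).SeparatesPoints := by
  intro x y hxy
  by_cases h1 : x.1 = y.1
  · have h2 : x.2 ≠ y.2 := fun h2 => hxy (Prod.ext h1 h2)
    refine ⟨_, ⟨stripMode R 0 ⟨fun t : ℝ => (t : ℂ), by fun_prop⟩,
      Algebra.subset_adjoin ⟨0, _, Complex.ofRealCLM.contDiff, rfl⟩, rfl⟩, ?_⟩
    simpa [stripMode, Subtype.ext_iff] using h2
  · refine ⟨_, ⟨stripMode R 1 1, Algebra.subset_adjoin ⟨1, 1, contDiff_const, rfl⟩, rfl⟩, ?_⟩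
    simp only [stripMode, ContinuousMap.coe_mk, ContinuousMap.one_apply, mul_one, fourier_one]
    intro h
    exact h1 (AddCircle.injective_toCircle Real.two_pi_pos.ne' (Subtype.coe_injective h))

/-- The generators contain 1 and are closed under products, so the Stone–Weierstrass approximants
are finite sums of products. -/
theorem stripAlgebra_toSubmodule (R : ℝ) :
    Subalgebra.toSubmodule (stripAlgebra R).toSubalgebra = Submodule.span ℂ (stripModes R) := by
  apply Algebra.adjoin_eq_span_of_subset
  refine Set.Subset.trans ?_ Submodule.subset_span
  intro x hx
  refine Submonoid.closure_induction (fun _ => id) ⟨0, 1, contDiff_const, ?_⟩ ?_ hx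
  · ext z; simp [stripMode]
  · rintro - - - - ⟨k, g, hg, rfl⟩ ⟨l, h, hh, rfl⟩
    refine ⟨k + l, g * h, hg.mul hh, ?_⟩
    ext z
    simp only [stripMode, ContinuousMap.mul_apply, ContinuousMap.coe_mk, fourier_add]
    ring

/-- Every element of the span of the products is of the form `∑_{k ∈ K} e^{ikx} h_k(t)`. -/
theorem exists_tens_of_mem_span {R : ℝ}
    {F : C(AddCircle (2 * Real.pi) × Set.Icc (-R) R, ℂ)}
    (hF : F ∈ Submodule.span ℂ (stripModes R)) :
    ∃ (K : Finset ℤ) (h : ℤ → ℝ → ℂ), (∀ k, ContDiff ℝ ∞ (h k)) ∧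
      ∀ z, F z = tens K h (z.1, z.2) := by
  induction hF using Submodule.span_induction with
  | mem F hF =>
    obtain ⟨k, h, hh, rfl⟩ := hF
    exact ⟨{k}, fun _ => h, fun _ => hh, fun z => by simp [tens, stripMode]⟩
  | zero => exact ⟨∅, 0, fun _ => contDiff_const, fun z => by simp [tens]⟩
  | add F F' _ _ ih ih' =>
    obtain ⟨K, h, hh, hF⟩ := ih
    obtain ⟨K', h', hh', hF'⟩ := ih'
    -- Coefficients are set to zero outside their own index set, so enlarging it to the union adds
    -- no terms.
    refine ⟨K ∪ K', fun k t => (if k ∈ K then h k t else 0) + if k ∈ K' then h' k t else 0,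
      fun k => ?_, fun z => ?_⟩
    · refine ContDiff.add ?_ ?_ <;> split_ifs
      exacts [hh k, contDiff_const, hh' k, contDiff_const]
    · rw [ContinuousMap.add_apply, hF, hF']
      simp only [tens, mul_add, Finset.sum_add_distrib, mul_ite, mul_zero]
      rw [Finset.sum_ite_mem, Finset.sum_ite_mem, Finset.union_inter_cancel_left,
        Finset.union_inter_cancel_right]
  | smul c F _ ih =>
    obtain ⟨K, h, hh, hF⟩ := ih
    refine ⟨K, fun k t => c * h k t, fun k => contDiff_const.mul (hh k), fun z => ?_⟩
    rw [ContinuousMap.smul_apply, hF, smul_eq_mul, tens, tens, Finset.mul_sum]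
    exact Finset.sum_congr rfl fun k _ => by ring

/-- A continuous function is uniformly close to smooth trigonometric sums on a compact strip. -/
theorem exists_tens_near {f : Cyl → ℂ} (hf : Continuous f) (R : ℝ) {δ : ℝ} (hδ : 0 < δ) :
    ∃ (K : Finset ℤ) (h : ℤ → ℝ → ℂ), (∀ k, ContDiff ℝ ∞ (h k)) ∧
      ∀ z : Cyl, |z.2| ≤ R → ‖f z - tens K h z‖ ≤ δ := by
  set F : C(AddCircle (2 * Real.pi) × Set.Icc (-R) R, ℂ) :=
    ⟨fun z => f (z.1, z.2), by fun_prop⟩ with hF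
  have hmem : F ∈ closure (stripAlgebra R : Set C(AddCircle (2 * Real.pi) × Set.Icc (-R) R, ℂ)) := by
    have := ContinuousMap.starSubalgebra_topologicalClosure_eq_top_of_separatesPoints _
      (stripAlgebra_separatesPoints R)
    rw [← StarSubalgebra.topologicalClosure_coe, this]
    trivial
  obtain ⟨P, hP, hFP⟩ := Metric.mem_closure_iff.1 hmem δ hδ
  have hP' : P ∈ Submodule.span ℂ (stripModes R) := by
    rw [← stripAlgebra_toSubmodule]; exact hP
  obtain ⟨K, h, hh, hKh⟩ := exists_tens_of_mem_span hP'
  refine ⟨K, h, hh, fun z hz => ?_⟩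
  have := ContinuousMap.dist_apply_le_dist (f := F) (g := P) (z.1, ⟨z.2, abs_le.1 hz⟩)
  rw [hKh, dist_eq_norm] at this
  exact this.trans hFP.le

/-- Smooth compactly supported trigonometric sums are dense in `L^p`. -/
theorem exists_tens_eLpNorm_sub_le {p : ℝ≥0∞} (hp : 1 ≤ p) (hpt : p ≠ ⊤) {f : Cyl → ℂ}
    (hf : MemLp f p volume) {ε : ℝ≥0∞} (hε : ε ≠ 0) :
    ∃ (K : Finset ℤ) (h : ℤ → ℝ → ℂ), (∀ k, ContDiff ℝ ∞ (h k)) ∧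
      (∀ k, HasCompactSupport (h k)) ∧ eLpNorm (f - tens K h) p volume ≤ ε := by
  have hp0 : p ≠ 0 := (zero_lt_one.trans_le hp).ne'
  have hε2 : ε / 2 ≠ 0 := by simpa using hε
  obtain ⟨g, hgs, hfg, hgc, hgp⟩ := hf.exists_hasCompactSupport_eLpNorm_sub_le hpt hε2
  obtain ⟨R₀, hR₀⟩ := (hgs.isCompact.image continuous_snd).isBounded.subset_closedBall 0
  set R : ℝ := max R₀ 1 with hR
  have hRpos : 0 < R := lt_max_of_lt_right one_pos
  have hg0 : ∀ z : Cyl, R < |z.2| → g z = 0 := by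
    intro z hz
    by_contra hne
    have := hR₀ ⟨z, subset_tsupport _ hne, rfl⟩
    rw [mem_closedBall_zero_iff, Real.norm_eq_abs] at this
    exact absurd (this.trans (le_max_left _ _)) (not_le.2 hz)
  -- A cutoff equal to 1 for `|t| ≤ R`, where `g` lives, and vanishing for `|t| ≥ R + 1`. Thus `g =
  -- χ g`, and multiplying the approximant by `χ` costs nothing in the error.
  let χ : ContDiffBump (0 : ℝ) := ⟨R, R + 1, hRpos, by linarith⟩
  set S : Set Cyl := {z | |z.2| ≤ R + 1} with hS
  have hSm : MeasurableSet S := (isClosed_le (by fun_prop) continuous_const).measurableSet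
  have hSv : volume S ≠ ⊤ := by
    have e : S = Set.univ ×ˢ Set.Icc (-(R + 1)) (R + 1) := by
      ext z; simp [hS, abs_le]
    rw [e, Measure.volume_eq_prod, Measure.prod_prod]
    exact ENNReal.mul_ne_top (measure_ne_top _ _) (by simp)
  have hVt : volume S ^ (1 / p.toReal) ≠ ⊤ := ENNReal.rpow_ne_top_of_nonneg (by positivity) hSv
  obtain ⟨δ, hδ0, hδ⟩ : ∃ δ : ℝ≥0, 0 < δ ∧ δ * volume S ^ (1 / p.toReal) < ε / 2 :=
    ENNReal.exists_nnreal_pos_mul_lt hVt hε2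
  obtain ⟨K, h, hh, hKh⟩ := exists_tens_near hgc (R + 1) (δ := δ) (by exact_mod_cast hδ0)
  refine ⟨K, fun k t => (χ t : ℂ) * h k t, fun k => ?_, fun k => ?_, ?_⟩
  · exact (Complex.ofRealCLM.contDiff.comp χ.contDiff).mul (hh k)
  · exact (χ.hasCompactSupport.comp_left (g := fun y : ℝ => (y : ℂ)) rfl).mul_right
  set P := tens K fun k t => (χ t : ℂ) * h k t with hP
  have hPe : ∀ z, P z = (χ z.2 : ℂ) * tens K h z := by
    intro z
    simp only [hP, tens, Finset.mul_sum]
    exact Finset.sum_congr rfl fun k _ => by ring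
  have hPc : Continuous P := by
    have h1 : ∀ k, Continuous (h k) := fun k => (hh k).continuous
    have h2 : Continuous (χ : ℝ → ℝ) := χ.continuous
    simp only [hP]
    unfold tens
    fun_prop
  have hδn : ‖(δ : ℝ)‖ = δ := by simp
  have hgP : ∀ z, ‖(g - P) z‖ ≤ ‖S.indicator (fun _ => (δ : ℝ)) z‖ := by
    intro z
    by_cases hz : z ∈ S
    · rw [Set.indicator_of_mem hz, hδn]
      have e : (g - P) z = (χ z.2 : ℂ) * (g z - tens K h z) := by
        rw [Pi.sub_apply, hPe, mul_sub]
        congr 1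
        by_cases hz' : |z.2| ≤ R
        · rw [χ.one_of_mem_closedBall (by simpa using hz'), Complex.ofReal_one, one_mul]
        · rw [hg0 z (not_le.1 hz'), mul_zero]
      rw [e, norm_mul, Complex.norm_of_nonneg χ.nonneg]
      calc _ ≤ 1 * (δ : ℝ) := mul_le_mul χ.le_one (hKh z hz) (norm_nonneg _) zero_le_one
        _ = _ := one_mul _
    · have hz' : R + 1 < |z.2| := not_le.1 hz
      rw [Set.indicator_of_notMem hz, Pi.sub_apply, hPe, hg0 z (by linarith),
        χ.zero_of_le_dist (by simpa using hz'.le)]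
      simp
  calc eLpNorm (f - P) p volume = eLpNorm ((f - g) + (g - P)) p volume := by
        rw [sub_add_sub_cancel]
    _ ≤ eLpNorm (f - g) p volume + eLpNorm (g - P) p volume :=
        eLpNorm_add_le (hf.sub hgp).aestronglyMeasurable
          (hgc.sub hPc).aestronglyMeasurable hp
    _ ≤ ε / 2 + ε / 2 := by
        refine add_le_add hfg ((eLpNorm_mono hgP).trans ?_)
        rw [eLpNorm_indicator_const hSm hp0 hpt]
        have : ‖(δ : ℝ)‖ₑ = (δ : ℝ≥0∞) := by
          rw [← ofReal_norm, hδn, ENNReal.ofReal_coe_nnreal]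
        rw [this]
        exact hδ.le
    _ = ε := ENNReal.add_halves ε

/-! ### Fourier inversion and the pairing with test functions. -/

/-- The Fourier coefficient function, normalized so that `expT (coef h) = h`. -/
def coef (h : ℝ → ℂ) (τ : ℝ) : ℂ :=
  (1 / (2 * Real.pi) : ℂ) * ∫ t : ℝ, h t * Complex.exp (-(Complex.I * t * τ))

open FourierTransform in
theorem coef_eq_fourier (h : ℝ → ℂ) (τ : ℝ) :
    coef h τ = (1 / (2 * Real.pi) : ℂ) * 𝓕 h (τ / (2 * Real.pi)) := by
  rw [Real.fourier_real_eq_integral_exp_smul, coef]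
  congr with t
  rw [smul_eq_mul, mul_comm]
  congr 2
  have := Real.pi_ne_zero
  push_cast
  field_simp

theorem fourier_toSchwartzMap {h : ℝ → ℂ} (hs : ContDiff ℝ ∞ h) (hc : HasCompactSupport h) :
    (FourierTransform.fourier (hc.toSchwartzMap hs) : ℝ → ℂ) = FourierTransform.fourier h := by
  rw [SchwartzMap.fourier_coe]; rfl

theorem integrable_coef {h : ℝ → ℂ} (hs : ContDiff ℝ ∞ h) (hc : HasCompactSupport h) :
    Integrable (coef h) := by
  have e : coef h = fun τ => (1 / (2 * Real.pi) : ℂ) *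
      FourierTransform.fourier (hc.toSchwartzMap hs) (τ / (2 * Real.pi)) := by
    ext τ; rw [coef_eq_fourier, fourier_toSchwartzMap hs hc]
  rw [e]
  exact ((SchwartzMap.integrable _).comp_div Real.two_pi_pos.ne').const_mul _

/-- Fourier inversion for Schwartz functions; the factor `1/(2π)` in `coef` cancels the Jacobian of
`τ = 2πξ`. -/
theorem expT_coef {h : ℝ → ℂ} (hs : ContDiff ℝ ∞ h) (hc : HasCompactSupport h)
    (t : ℝ) : expT (coef h) t = h t := by
  set φ := hc.toSchwartzMap hs with hφ
  have h1 : expT (coef h) t = ∫ τ : ℝ, (fun ξ : ℝ => (1 / (2 * Real.pi) : ℂ) *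
      (FourierTransform.fourier φ ξ * Complex.exp (2 * Real.pi * t * ξ * Complex.I)))
        (τ / (2 * Real.pi)) := by
    rw [expT]
    congr with τ
    rw [coef_eq_fourier, ← fourier_toSchwartzMap hs hc]
    have hpi : (Real.pi : ℂ) ≠ 0 := by exact_mod_cast Real.pi_ne_zero
    have : Complex.I * t * τ = 2 * Real.pi * t * ((τ / (2 * Real.pi) : ℝ) : ℂ) * Complex.I := by
      push_cast; field_simp
    rw [this]
    ring
  rw [h1, Measure.integral_comp_div (fun ξ : ℝ => (1 / (2 * Real.pi) : ℂ) *
      (FourierTransform.fourier φ ξ * Complex.exp (2 * Real.pi * t * ξ * Complex.I))),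
    integral_const_mul, abs_of_pos Real.two_pi_pos]
  have h2 : FourierTransform.fourierInv (FourierTransform.fourier φ) t = φ t := by
    rw [FourierTransform.fourierInv_fourier_eq]
  rw [SchwartzMap.fourierInv_coe, Real.fourierInv_eq'] at h2
  have h3 : ∫ ξ : ℝ, FourierTransform.fourier φ ξ *
      Complex.exp (2 * Real.pi * t * ξ * Complex.I) = φ t := by
    rw [← h2]
    congr with ξ
    rw [smul_eq_mul, mul_comm]
    congr 2
    simp only [RCLike.inner_apply, conj_trivial]
    push_cast
    ring
  rw [h3, Complex.real_smul]
  have hpi : (Real.pi : ℂ) ≠ 0 := by exact_mod_cast Real.pi_ne_zero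
  push_cast
  rw [← mul_assoc, mul_one_div_cancel (by simp), one_mul]
  rfl

theorem tens_eq_trig (K : Finset ℤ) {h : ℤ → ℝ → ℂ} (hs : ∀ k, ContDiff ℝ ∞ (h k))
    (hc : ∀ k, HasCompactSupport (h k)) : tens K h = trig K fun k => coef (h k) := by
  ext z
  simp only [tens, trig, expT_coef (hs _) (hc _)]

theorem fourierST_tens (K : Finset ℤ) (h : ℤ → ℝ → ℂ) {k : ℤ} (hk : k ∈ K) (τ : ℝ) :
    fourierST (tens K h) k τ = 2 * Real.pi * coef (h k) τ := by
  have h1 : ∀ t : ℝ, ∫ x : AddCircle (2 * Real.pi),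
      tens K h (x, t) * fourier (-k) x * Complex.exp (-(Complex.I * t * τ)) =
      2 * Real.pi * (h k t * Complex.exp (-(Complex.I * t * τ))) := by
    intro t
    have e : ∀ x : AddCircle (2 * Real.pi),
        tens K h (x, t) * fourier (-k) x * Complex.exp (-(Complex.I * t * τ)) =
        ∑ m ∈ K, (h m t * Complex.exp (-(Complex.I * t * τ))) *
          (fourier m x * (starRingEnd ℂ) (fourier k x)) := by
      intro x
      rw [tens, Finset.sum_mul, Finset.sum_mul]
      refine Finset.sum_congr rfl fun m _ => ?_
      rw [fourier_neg]; ring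
    simp_rw [e]
    rw [integral_finsetSum]
    · simp_rw [integral_const_mul, integral_fourier_mul_conj]
      simp only [mul_ite, mul_zero, Finset.sum_ite_eq', hk, if_true]
      push_cast; ring
    · intro m _
      exact Continuous.integrable_of_hasCompactSupport (by fun_prop)
        (HasCompactSupport.of_compactSpace _)
  rw [fourierST]
  simp_rw [h1]
  rw [integral_const_mul, coef]
  ring

/-- From `max 1 |y| ≤ ⟨y⟩`. The same inequality, raised to a positive power, gives
`le_schwartzNorm_third`, so no reverse comparison is needed. -/
theorem schwartzNorm_neg_third_le (α μ : ℝ) (v : Schwartz) :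
    schwartzNorm α μ 0 (-(1 / 3)) v ≤
      (∑' k : ℤ, ∫⁻ τ, rho α μ k τ * ‖fourierST (v : Cyl → ℂ) k τ‖ₑ ^ 2) ^ (1 / 2 : ℝ) := by
  refine ENNReal.rpow_le_rpow (ENNReal.tsum_le_tsum fun k => lintegral_mono fun τ => ?_)
    (by norm_num)
  refine mul_le_mul_left (ENNReal.ofReal_le_ofReal ?_) _
  rw [mul_zero, Real.rpow_zero, one_mul, wt,
    show (2 * -(1 / 3) : ℝ) = -(2 / 3) by norm_num]
  refine Real.rpow_le_rpow_of_nonpos (by positivity) ?_ (by norm_num)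
  rw [bracket]
  refine max_le (Real.le_sqrt_of_sq_le ?_) (Real.le_sqrt_of_sq_le ?_)
  · nlinarith [sq_nonneg |τ - phase α μ k|]
  · linarith

theorem le_schwartzNorm_third (α μ : ℝ) (v : Schwartz) :
    (∑' k : ℤ, ∫⁻ τ, (rho α μ k τ)⁻¹ * ‖fourierST (v : Cyl → ℂ) k τ‖ₑ ^ 2) ^ (1 / 2 : ℝ) ≤
      schwartzNorm α μ 0 (1 / 3) v := by
  refine ENNReal.rpow_le_rpow (ENNReal.tsum_le_tsum fun k => lintegral_mono fun τ => ?_)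
    (by norm_num)
  refine mul_le_mul_left ?_ _
  rw [rho, ← ENNReal.ofReal_inv_of_pos (wt_pos _)]
  refine ENNReal.ofReal_le_ofReal ?_
  rw [mul_zero, Real.rpow_zero, one_mul, wt, ← Real.rpow_neg (by positivity), neg_neg,
    show (2 * (1 / 3) : ℝ) = 2 / 3 by norm_num]
  refine Real.rpow_le_rpow (by positivity) ?_ (by norm_num)
  rw [bracket]
  refine max_le (Real.le_sqrt_of_sq_le ?_) (Real.le_sqrt_of_sq_le ?_)
  · nlinarith [sq_nonneg |τ - phase α μ k|]
  · linarith

/-- The duality between the `X_{0,1/3}` norm and the `L^{4/3}` norm. -/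
theorem enorm_integral_mul_tens_le {α : ℝ} (hα : 0 < α) :
    ∃ C : ℝ≥0, ∀ (μ : ℝ) (v : Schwartz) (K : Finset ℤ) (h : ℤ → ℝ → ℂ),
      (∀ k, ContDiff ℝ ∞ (h k)) → (∀ k, HasCompactSupport (h k)) →
      ‖∫ z, (v : Cyl → ℂ) z * tens K h z‖ₑ ≤
        C * schwartzNorm α μ 0 (1 / 3) v * eLpNorm (tens K h) (4 / 3) volume := by
  obtain ⟨C, hC⟩ := dual_estimate hα
  refine ⟨C, fun μ v K h hs hc => ?_⟩
  have hv := integrable_schwartz v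
  have hψ := integrable_schwartz ⟨_, tens_mem_schwartz K hs hc⟩
  have hψC := hC μ _ hψ
  set F := fourierST (v : Cyl → ℂ) with hF
  have hFm : ∀ k, Measurable fun τ => ‖F (-k) (-τ)‖ₑ := fun k =>
    ((continuous_fourierST hv (-k)).comp continuous_neg).measurable.enorm
  have hGm : ∀ k, Measurable fun τ => ‖fourierST (tens K h) k τ‖ₑ := fun k =>
    (continuous_fourierST hψ k).measurable.enorm
  have h1 : ∫ z, (v : Cyl → ℂ) z * tens K h z =
      ∑ k ∈ K, ∫ τ, fourierST (tens K h) k τ * F (-k) (-τ) := by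
    rw [tens_eq_trig K hs hc, integral_mul_trig hv K fun k => integrable_coef (hs k) (hc k),
      Finset.mul_sum, ← tens_eq_trig K hs hc]
    refine Finset.sum_congr rfl fun k hk => ?_
    rw [← integral_const_mul]
    congr with τ
    rw [fourierST_tens K h hk]
    ring
  have h2 : ‖∫ z, (v : Cyl → ℂ) z * tens K h z‖ₑ ≤
      ∑ k ∈ K, ∫⁻ τ, ‖fourierST (tens K h) k τ‖ₑ * ‖F (-k) (-τ)‖ₑ := by
    rw [h1]
    refine (enorm_sum_le _ _).trans (Finset.sum_le_sum fun k _ => ?_)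
    refine (enorm_integral_le_lintegral_enorm _).trans_eq ?_
    simp_rw [enorm_mul]
  -- Cauchy–Schwarz with weights `ρ` and `ρ⁻¹`: the first factor falls under the dual estimate, the
  -- second under the `X_{0,1/3}` norm of `v`.
  have h3 : ‖∫ z, (v : Cyl → ℂ) z * tens K h z‖ₑ ^ 2 ≤
      (∑' k : ℤ, ∫⁻ τ, rho α μ k τ * ‖fourierST (tens K h) k τ‖ₑ ^ 2) *
      ∑' k : ℤ, ∫⁻ τ, (rho α μ k τ)⁻¹ * ‖F k τ‖ₑ ^ 2 := by
    rw [← tsum_neg_neg (w := fun k τ => (rho α μ k τ)⁻¹) (fun k τ => by rw [rho_neg])]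
    calc _ ≤ (∑ k ∈ K, ∫⁻ τ, ‖fourierST (tens K h) k τ‖ₑ * ‖F (-k) (-τ)‖ₑ) ^ 2 := by gcongr
      _ ≤ (∑ k ∈ K, ∫⁻ τ, rho α μ k τ * ‖fourierST (tens K h) k τ‖ₑ ^ 2) *
          ∑ k ∈ K, ∫⁻ τ, (rho α μ k τ)⁻¹ * ‖F (-k) (-τ)‖ₑ ^ 2 :=
        sq_sum_le_of_sq_le _ fun k _ => sq_lintegral_mul_le (measurable_rho α μ k) (hGm k) (hFm k)
          (rho_ne_zero α μ k) (rho_ne_top α μ k)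
      _ ≤ _ := mul_le_mul' (ENNReal.sum_le_tsum K) (ENNReal.sum_le_tsum K)
  calc ‖∫ z, (v : Cyl → ℂ) z * tens K h z‖ₑ
      ≤ (∑' k : ℤ, ∫⁻ τ, rho α μ k τ * ‖fourierST (tens K h) k τ‖ₑ ^ 2) ^ (1 / 2 : ℝ) *
        (∑' k : ℤ, ∫⁻ τ, (rho α μ k τ)⁻¹ * ‖F k τ‖ₑ ^ 2) ^ (1 / 2 : ℝ) := by
        have := ENNReal.rpow_le_rpow h3 (by norm_num : (0 : ℝ) ≤ 1 / 2)
        rw [ENNReal.mul_rpow_of_nonneg _ _ (by norm_num), ← ENNReal.rpow_natCast,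
          ← ENNReal.rpow_mul] at this
        simpa using this
    _ ≤ (C * eLpNorm (tens K h) (4 / 3) volume) * schwartzNorm α μ 0 (1 / 3) v :=
        mul_le_mul' hψC (le_schwartzNorm_third α μ v)
    _ = _ := by ring

theorem schwartzNorm_le_eLpNorm {α : ℝ} (hα : 0 < α) :
    ∃ C : ℝ≥0, ∀ (μ : ℝ) (v : Schwartz),
      schwartzNorm α μ 0 (-(1 / 3)) v ≤ C * eLpNorm (v : Cyl → ℂ) (4 / 3) volume := by
  obtain ⟨C, hC⟩ := dual_estimate hα
  exact ⟨C, fun μ v => (schwartzNorm_neg_third_le α μ v).trans (hC μ v (integrable_schwartz v))⟩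

/-! ### The `L⁴` norm by testing. -/

theorem tendsto_inv_nat_succ : Tendsto (fun n : ℕ => ((n : ℝ≥0∞) + 1)⁻¹) atTop (𝓝 0) := by
  have := (tendsto_add_atTop_iff_nat 1).2 ENNReal.tendsto_inv_nat_nhds_zero
  simpa using this

/-- Schwartz functions approximate any function in `L^{4/3}`. -/
theorem exists_seq_tens {f : Cyl → ℂ} (hf : MemLp f (4 / 3) volume) :
    ∃ (K : ℕ → Finset ℤ) (h : ℕ → ℤ → ℝ → ℂ), (∀ n k, ContDiff ℝ ∞ (h n k)) ∧
      (∀ n k, HasCompactSupport (h n k)) ∧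
      Tendsto (fun n => eLpNorm (f - tens (K n) (h n)) (4 / 3) volume) atTop (𝓝 0) := by
  have hex := fun n : ℕ => exists_tens_eLpNorm_sub_le one_le_four_thirds four_thirds_ne_top hf
    (ε := ((n : ℝ≥0∞) + 1)⁻¹) (by simp)
  choose K h hs hc hle using hex
  exact ⟨K, h, hs, hc, tendsto_of_tendsto_of_tendsto_of_le_of_le tendsto_const_nhds
    tendsto_inv_nat_succ (fun _ => zero_le) hle⟩

theorem tendsto_enorm_sub {X : Type*} {l : Filter X} {a : X → ℂ} {b : ℂ}
    (h : Tendsto (fun x => ‖a x - b‖ₑ) l (𝓝 0)) : Tendsto a l (𝓝 b) := by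
  rw [tendsto_iff_edist_tendsto_0]
  simpa only [edist_eq_enorm_sub] using h

theorem enorm_integral_mul_sub_le {u g ψ : Cyl → ℂ} (hu : MemLp u 4 volume)
    (hg : MemLp g (4 / 3) volume) (hψ : MemLp ψ (4 / 3) volume) :
    ‖(∫ z, u z * ψ z) - ∫ z, u z * g z‖ₑ ≤
      eLpNorm u 4 volume * eLpNorm (g - ψ) (4 / 3) volume := by
  have hi : ∀ φ : Cyl → ℂ, MemLp φ (4 / 3) volume → Integrable fun z => u z * φ z :=
    fun φ hφ => hu.integrable_mul hφ
  rw [← integral_sub (hi ψ hψ) (hi g hg), ← eLpNorm_sub_comm,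
    mul_comm (eLpNorm u 4 volume)]
  refine le_trans (le_of_eq ?_) (enorm_integral_mul_le (hψ.sub hg).aestronglyMeasurable
    hu.aestronglyMeasurable)
  congr 1
  refine integral_congr_ae (ae_of_all _ fun z => ?_)
  simp only [Pi.sub_apply]
  ring

theorem memLp_tens (K : Finset ℤ) {h : ℤ → ℝ → ℂ} (hs : ∀ k, ContDiff ℝ ∞ (h k))
    (hc : ∀ k, HasCompactSupport (h k)) : MemLp (tens K h) (4 / 3) volume :=
  memLp_schwartz ⟨_, tens_mem_schwartz K hs hc⟩ one_le_four_thirds four_thirds_ne_top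

/-- A bound for the pairing with test functions extends to all of `L^{4/3}`. -/
theorem enorm_integral_mul_le_of_tens {u : Cyl → ℂ} (hu : MemLp u 4 volume) {D : ℝ≥0∞}
    (hD : D ≠ ⊤)
    (hb : ∀ (K : Finset ℤ) (h : ℤ → ℝ → ℂ), (∀ k, ContDiff ℝ ∞ (h k)) →
      (∀ k, HasCompactSupport (h k)) →
      ‖∫ z, u z * tens K h z‖ₑ ≤ D * eLpNorm (tens K h) (4 / 3) volume)
    {g : Cyl → ℂ} (hg : MemLp g (4 / 3) volume) :
    ‖∫ z, u z * g z‖ₑ ≤ D * eLpNorm g (4 / 3) volume := by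
  obtain ⟨K, h, hs, hc, hlim⟩ := exists_seq_tens hg
  set ψ : ℕ → Cyl → ℂ := fun n => tens (K n) (h n) with hψ
  have hψm : ∀ n, MemLp (ψ n) (4 / 3) volume := fun n => memLp_tens _ (hs n) (hc n)
  have h1 : Tendsto (fun n => ∫ z, u z * ψ n z) atTop (𝓝 (∫ z, u z * g z)) := by
    refine tendsto_enorm_sub (tendsto_of_tendsto_of_tendsto_of_le_of_le tendsto_const_nhds ?_
      (fun _ => zero_le) fun n => enorm_integral_mul_sub_le hu hg (hψm n))
    simpa using ENNReal.Tendsto.const_mul hlim (Or.inr hu.eLpNorm_ne_top)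
  have h2 : ∀ n, ‖∫ z, u z * ψ n z‖ₑ ≤
      D * (eLpNorm g (4 / 3) volume + eLpNorm (g - ψ n) (4 / 3) volume) := by
    intro n
    refine (hb _ _ (hs n) (hc n)).trans ?_
    gcongr
    calc eLpNorm (ψ n) (4 / 3) volume = eLpNorm (g - (g - ψ n)) (4 / 3) volume := by
          rw [sub_sub_cancel]
      _ ≤ _ := eLpNorm_sub_le hg.aestronglyMeasurable
          (hg.sub (hψm n)).aestronglyMeasurable one_le_four_thirds
  refine le_of_tendsto_of_tendsto' h1.enorm ?_ h2
  simpa using ENNReal.Tendsto.const_mul (tendsto_const_nhds.add hlim) (Or.inr hD)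

/-- Test functions detect the `L⁴` norm. -/
theorem eLpNorm_four_le_of_tens {u : Cyl → ℂ} (hu : MemLp u 4 volume) {D : ℝ≥0∞} (hD : D ≠ ⊤)
    (hb : ∀ (K : Finset ℤ) (h : ℤ → ℝ → ℂ), (∀ k, ContDiff ℝ ∞ (h k)) →
      (∀ k, HasCompactSupport (h k)) →
      ‖∫ z, u z * tens K h z‖ₑ ≤ D * eLpNorm (tens K h) (4 / 3) volume) :
    eLpNorm u 4 volume ≤ D := by
  set A := eLpNorm u 4 volume with hA
  have hAt : A ≠ ⊤ := hu.eLpNorm_ne_top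
  rcases eq_or_ne A 0 with h0 | h0
  · rw [h0]; exact zero_le
  -- The extremal function `|u|² ū` for Hölder: `‖g‖_{4/3} = A³` and `∫ u g = A⁴`. Cancelling `A³`
  -- uses `A` finite and nonzero.
  set g : Cyl → ℂ := fun z => (‖u z‖ ^ 2 : ℝ) • (starRingEnd ℂ) (u z) with hg
  have hgn : ∀ z, ‖g z‖ₑ = ‖u z‖ₑ ^ 3 := by
    intro z
    rw [hg]
    simp only [enorm_smul, RCLike.enorm_conj]
    rw [← ofReal_norm (‖u z‖ ^ 2), Real.norm_of_nonneg (by positivity), ofReal_sq_norm]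
    ring
  have hgm : AEStronglyMeasurable g volume :=
    (hu.aestronglyMeasurable.norm.pow 2).smul
      (Complex.continuous_conj.comp_aestronglyMeasurable hu.aestronglyMeasurable)
  have hgA : eLpNorm g (4 / 3) volume = A ^ 3 := by
    have e4 : A ^ 4 = ∫⁻ z, ‖u z‖ₑ ^ 4 := eLpNorm_four_pow u
    have hp0 : (4 / 3 : ℝ≥0∞) ≠ 0 := (zero_lt_one.trans_le one_le_four_thirds).ne'
    have hpr : (4 / 3 : ℝ≥0∞).toReal = 4 / 3 := by simp [ENNReal.toReal_div]
    rw [eLpNorm_eq_lintegral_rpow_enorm_toReal hp0 four_thirds_ne_top, hpr]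
    have e : ∀ z, ‖g z‖ₑ ^ (4 / 3 : ℝ) = ‖u z‖ₑ ^ 4 := by
      intro z
      rw [hgn, ← ENNReal.rpow_natCast, ← ENNReal.rpow_mul, ← ENNReal.rpow_natCast]
      norm_num
    simp_rw [e]
    rw [← e4, ← ENNReal.rpow_natCast, ← ENNReal.rpow_mul, ← ENNReal.rpow_natCast]
    norm_num
  have hgL : MemLp g (4 / 3) volume :=
    ⟨hgm, by rw [hgA]; exact (ENNReal.pow_ne_top hAt).lt_top⟩
  have hint : ‖∫ z, u z * g z‖ₑ = A ^ 4 := by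
    have e : ∀ z, u z * g z = ((‖u z‖ ^ 4 : ℝ) : ℂ) := by
      intro z
      simp only [hg, Complex.real_smul]
      rw [mul_left_comm, Complex.mul_conj, Complex.normSq_eq_norm_sq]
      push_cast; ring
    have hi : Integrable fun z => ‖u z‖ ^ 4 := by
      have := (hu.integrable_mul hgL).norm
      refine this.congr (ae_of_all _ fun z => ?_)
      simp only [Pi.mul_apply]
      rw [e, Complex.norm_of_nonneg (by positivity)]
    simp_rw [e]
    rw [integral_complex_ofReal, ← ofReal_norm, Complex.norm_of_nonneg
      (integral_nonneg fun z => by positivity), ofReal_integral_eq_lintegral_ofReal hi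
      (ae_of_all _ fun z => by positivity), hA, eLpNorm_four_pow]
    refine lintegral_congr fun z => ?_
    rw [ENNReal.ofReal_pow (norm_nonneg _), ofReal_norm]
  have key := enorm_integral_mul_le_of_tens hu hD hb hgL
  rw [hint, hgA, pow_succ' A 3] at key
  exact (ENNReal.mul_le_mul_iff_left (pow_ne_zero 3 h0) (ENNReal.pow_ne_top hAt)).1 key

/-- The `L⁴` Strichartz estimate for Schwartz functions. -/
theorem eLpNorm_four_le_schwartzNorm {α : ℝ} (hα : 0 < α) :
    ∃ C : ℝ≥0, 0 < C ∧ ∀ (μ : ℝ) (v : Schwartz),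
      eLpNorm (v : Cyl → ℂ) 4 volume ≤ C * schwartzNorm α μ 0 (1 / 3) v := by
  obtain ⟨C, hC⟩ := enorm_integral_mul_tens_le hα
  -- A positive constant is wanted so that one may later divide by it; it also makes the case of
  -- infinite norm trivial.
  refine ⟨C + 1, by positivity, fun μ v => ?_⟩
  by_cases hN : schwartzNorm α μ 0 (1 / 3) v = ⊤
  · rw [hN, ENNReal.mul_top (by simp)]; exact le_top
  · refine (eLpNorm_four_le_of_tens (memLp_schwartz v (by norm_num) (by norm_num))
      (ENNReal.mul_ne_top ENNReal.coe_ne_top hN) (hC μ v)).trans ?_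
    gcongr
    simp

/-! ### Passage to the closures. -/

/-- The function representing a tempered distribution is unique in `L⁴`. -/
theorem TemperedDist.IsFunction.ae_eq {u : TemperedDist} {f g : Cyl → ℂ} (hf : u.IsFunction f)
    (hg : u.IsFunction g) (hf4 : MemLp f 4 volume) (hg4 : MemLp g 4 volume) :
    f =ᵐ[volume] g := by
  have h0 : eLpNorm (f - g) 4 volume ≤ 0 := by
    refine eLpNorm_four_le_of_tens (hf4.sub hg4) ENNReal.zero_ne_top fun K h hs hc => ?_
    have h1 := hf ⟨_, tens_mem_schwartz K hs hc⟩
    have h2 := hg ⟨_, tens_mem_schwartz K hs hc⟩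
    have : ∫ z, (f - g) z * tens K h z = 0 := by
      simp only [Pi.sub_apply, sub_mul]
      rw [integral_sub h1.1 h2.1, sub_eq_zero, ← h1.2, ← h2.2]
    rw [this]
    simp
  have := (eLpNorm_eq_zero_iff (hf4.sub hg4).aestronglyMeasurable (by norm_num)).1
    (le_antisymm h0 zero_le)
  filter_upwards [this] with z hz
  exact sub_eq_zero.1 hz

/-- An approximating sequence that is Cauchy in `L⁴` represents its limit by an `L⁴` function. -/
theorem exists_isFunction_of_cauchy {u : TemperedDist} {w : ℕ → Schwartz}
    (hw : Tendsto (fun p : ℕ × ℕ => eLpNorm ((w p.1 : Cyl → ℂ) - (w p.2 : Cyl → ℂ)) 4 volume)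
      atTop (𝓝 0))
    (hu : ∀ ψ : Schwartz,
      Tendsto (fun j => ∫ z, (w j : Cyl → ℂ) z * (ψ : Cyl → ℂ) z) atTop (𝓝 (u ψ))) :
    ∃ f : Cyl → ℂ, MemLp f 4 volume ∧ u.IsFunction f ∧
      Tendsto (fun j => eLpNorm ((w j : Cyl → ℂ) - f) 4 volume) atTop (𝓝 0) := by
  have : Fact ((1 : ℝ≥0∞) ≤ 4) := ⟨by norm_num⟩
  have hm : ∀ j, MemLp (w j : Cyl → ℂ) 4 volume := fun j =>
    memLp_schwartz (w j) (by norm_num) (by norm_num)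
  have hcau : CauchySeq fun j => (hm j).toLp := by
    rw [cauchySeq_iff_tendsto_dist_atTop_0]
    have := (ENNReal.tendsto_toReal ENNReal.zero_ne_top).comp hw
    simp only [ENNReal.toReal_zero] at this
    refine this.congr fun p => ?_
    rw [Lp.dist_edist, Lp.edist_toLp_toLp]; rfl
  obtain ⟨F', hF⟩ := cauchySeq_tendsto_of_complete hcau
  set F : Cyl → ℂ := fun z => F' z with hF_def
  have hlim : Tendsto (fun j => eLpNorm ((w j : Cyl → ℂ) - F) 4 volume) atTop (𝓝 0) := by
    rw [Lp.tendsto_Lp_iff_tendsto_eLpNorm'] at hF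
    refine hF.congr fun j => eLpNorm_congr_ae ?_
    filter_upwards [(hm j).coeFn_toLp] with z hz
    simp only [Pi.sub_apply, hz, hF_def]
  have hF4 : MemLp F 4 volume := Lp.memLp F'
  refine ⟨F, hF4, fun ψ => ?_, hlim⟩
  have hψ : MemLp (ψ : Cyl → ℂ) (4 / 3) volume :=
    memLp_schwartz ψ one_le_four_thirds four_thirds_ne_top
  have hi : ∀ φ : Cyl → ℂ, MemLp φ 4 volume → Integrable fun z => φ z * (ψ : Cyl → ℂ) z :=
    fun φ hφ => hφ.integrable_mul hψ
  -- The pairings with `w j` tend to `u ψ` by hypothesis and to `∫ F ψ` by Hölder.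
  refine ⟨hi F hF4, tendsto_nhds_unique (hu ψ) (tendsto_enorm_sub ?_)⟩
  have hle : ∀ j, ‖(∫ z, (w j : Cyl → ℂ) z * (ψ : Cyl → ℂ) z) -
      ∫ z, F z * (ψ : Cyl → ℂ) z‖ₑ ≤
      eLpNorm (ψ : Cyl → ℂ) (4 / 3) volume * eLpNorm ((w j : Cyl → ℂ) - F) 4 volume := by
    intro j
    rw [← integral_sub (hi _ (hm j)) (hi _ hF4)]
    refine le_trans (le_of_eq ?_) (enorm_integral_mul_le hψ.aestronglyMeasurable
      ((hm j).sub hF4).aestronglyMeasurable)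
    congr 1
    refine integral_congr_ae (ae_of_all _ fun z => ?_)
    simp only [Pi.sub_apply]
    ring
  refine tendsto_of_tendsto_of_tendsto_of_le_of_le tendsto_const_nhds ?_ (fun _ => zero_le) hle
  simpa using ENNReal.Tendsto.const_mul hlim (Or.inr hψ.eLpNorm_ne_top)

/-- The `L⁴` bound on differences makes the sequence Cauchy in `L⁴`, and the bound on its terms
passes to the limit. The function produced depends a priori on the sequence. -/
theorem exists_isFunction_of_approximates {α μ : ℝ} {C : ℝ≥0}
    (hC : ∀ v : Schwartz, eLpNorm (v : Cyl → ℂ) 4 volume ≤ C * schwartzNorm α μ 0 (1 / 3) v)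
    {u : TemperedDist} {w : ℕ → Schwartz} (hw : Approximates α μ 0 (1 / 3) w u) :
    ∃ f : Cyl → ℂ, MemLp f 4 volume ∧ u.IsFunction f ∧
      ∀ N, Tendsto (fun j => schwartzNorm α μ 0 (1 / 3) (w j)) atTop (𝓝 N) →
        eLpNorm f 4 volume ≤ C * N := by
  have hcau : Tendsto (fun p : ℕ × ℕ =>
      eLpNorm ((w p.1 : Cyl → ℂ) - (w p.2 : Cyl → ℂ)) 4 volume) atTop (𝓝 0) := by
    refine tendsto_of_tendsto_of_tendsto_of_le_of_le tendsto_const_nhds ?_ (fun _ => zero_le)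
      fun p => hC (w p.1 - w p.2)
    simpa using ENNReal.Tendsto.const_mul hw.cauchy (Or.inr (ENNReal.coe_ne_top (r := C)))
  obtain ⟨f, hf, huf, hlim⟩ := exists_isFunction_of_cauchy hcau hw.tendsto
  refine ⟨f, hf, huf, fun N hN => ?_⟩
  have hle : ∀ j, eLpNorm f 4 volume ≤
      C * schwartzNorm α μ 0 (1 / 3) (w j) + eLpNorm ((w j : Cyl → ℂ) - f) 4 volume := by
    intro j
    have hm := memLp_schwartz (w j) (p := 4) (by norm_num) (by norm_num)
    calc eLpNorm f 4 volume = eLpNorm ((w j : Cyl → ℂ) - ((w j : Cyl → ℂ) - f)) 4 volume := by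
          rw [sub_sub_cancel]
      _ ≤ eLpNorm (w j : Cyl → ℂ) 4 volume + eLpNorm ((w j : Cyl → ℂ) - f) 4 volume :=
          eLpNorm_sub_le hm.aestronglyMeasurable (hm.sub hf).aestronglyMeasurable (by norm_num)
      _ ≤ _ := by gcongr; exact hC (w j)
  have hsum := (ENNReal.Tendsto.const_mul hN (Or.inr (ENNReal.coe_ne_top (r := C)))).add hlim
  rw [add_zero] at hsum
  exact ge_of_tendsto' hsum hle

/-- Elements of `X_{0,1/3}` are `L⁴` functions. -/
theorem exists_isFunction_of_mem_bourgainSpace {α μ : ℝ} {C : ℝ≥0} (hC0 : 0 < C)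
    (hC : ∀ v : Schwartz, eLpNorm (v : Cyl → ℂ) 4 volume ≤ C * schwartzNorm α μ 0 (1 / 3) v)
    {u : TemperedDist} (hu : u ∈ bourgainSpace α μ 0 (1 / 3)) :
    ∃ f : Cyl → ℂ, MemLp f 4 volume ∧ u.IsFunction f ∧
      eLpNorm f 4 volume ≤ C * bourgainNorm α μ 0 (1 / 3) u := by
  obtain ⟨w, hw⟩ := hu
  obtain ⟨f, hf, huf, -⟩ := exists_isFunction_of_approximates hC hw
  refine ⟨f, hf, huf, ?_⟩
  have hC0' : (C : ℝ≥0∞) ≠ 0 := by simpa using hC0.ne'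
  rw [← ENNReal.div_le_iff' hC0' ENNReal.coe_ne_top, bourgainNorm]
  refine le_sInf ?_
  rintro N ⟨w', hw', hN⟩
  rw [ENNReal.div_le_iff' hC0' ENNReal.coe_ne_top]
  -- The norm is an infimum over all approximating sequences. Another sequence yields another
  -- representative, equal to `f` almost everywhere by uniqueness.
  obtain ⟨g, hg, hug, hgN⟩ := exists_isFunction_of_approximates hC hw'
  rw [eLpNorm_congr_ae (huf.ae_eq hug hf hg)]
  exact hgN N hN

theorem Approximates.comp_strictMono {α μ s b : ℝ} {w : ℕ → Schwartz} {u : TemperedDist}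
    (h : Approximates α μ s b w u) {φ : ℕ → ℕ} (hφ : StrictMono φ) :
    Approximates α μ s b (fun j => w (φ j)) u := by
  have h1 : Tendsto (fun p : ℕ × ℕ => (φ p.1, φ p.2)) atTop atTop := by
    rw [← prod_atTop_atTop_eq]
    exact hφ.tendsto_atTop.prodMap hφ.tendsto_atTop
  have h2 := h.cauchy.comp h1
  refine ⟨?_, fun ψ => ?_⟩
  · simpa only [Function.comp_def] using h2
  · have h3 := (h.tendsto ψ).comp hφ.tendsto_atTop
    simpa only [Function.comp_def] using h3

/-- Functions in `L^{4/3}` belong to `X_{0,-1/3}`. -/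
theorem ofMemLp_mem_bourgainSpace {α μ : ℝ} {C : ℝ≥0}
    (hC : ∀ v : Schwartz,
      schwartzNorm α μ 0 (-(1 / 3)) v ≤ C * eLpNorm (v : Cyl → ℂ) (4 / 3) volume)
    {f : Cyl → ℂ} (hf : MemLp f (4 / 3) volume) :
    ofMemLp f hf ∈ bourgainSpace α μ 0 (-(1 / 3)) ∧
      bourgainNorm α μ 0 (-(1 / 3)) (ofMemLp f hf) ≤ C * eLpNorm f (4 / 3) volume := by
  obtain ⟨K, h, hs, hc, hlim⟩ := exists_seq_tens hf
  set w : ℕ → Schwartz := fun n => ⟨_, tens_mem_schwartz (K n) (hs n) (hc n)⟩ with hw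
  have hwm : ∀ n, MemLp (w n : Cyl → ℂ) (4 / 3) volume := fun n =>
    memLp_schwartz (w n) one_le_four_thirds four_thirds_ne_top
  have hCt : (C : ℝ≥0∞) ≠ ⊤ := ENNReal.coe_ne_top
  have happ : Approximates α μ 0 (-(1 / 3)) w (ofMemLp f hf) := by
    refine ⟨?_, fun ψ => tendsto_enorm_sub ?_⟩
    · have hle : ∀ p : ℕ × ℕ, schwartzNorm α μ 0 (-(1 / 3)) (w p.1 - w p.2) ≤
          C * (eLpNorm (f - (w p.2 : Cyl → ℂ)) (4 / 3) volume +
            eLpNorm (f - (w p.1 : Cyl → ℂ)) (4 / 3) volume) := by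
        intro p
        refine (hC _).trans ?_
        gcongr
        calc eLpNorm ((w p.1 - w p.2 : Schwartz) : Cyl → ℂ) (4 / 3) volume
            = eLpNorm ((f - (w p.2 : Cyl → ℂ)) - (f - (w p.1 : Cyl → ℂ))) (4 / 3) volume := by
              rw [sub_sub_sub_cancel_left]; rfl
          _ ≤ _ := eLpNorm_sub_le (hf.sub (hwm _)).aestronglyMeasurable
              (hf.sub (hwm _)).aestronglyMeasurable one_le_four_thirds
      refine tendsto_of_tendsto_of_tendsto_of_le_of_le tendsto_const_nhds ?_ (fun _ => zero_le) hle
      have h1 : Tendsto (fun p : ℕ × ℕ => p.1) atTop atTop := by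
        rw [← prod_atTop_atTop_eq]; exact tendsto_fst
      have h2 : Tendsto (fun p : ℕ × ℕ => p.2) atTop atTop := by
        rw [← prod_atTop_atTop_eq]; exact tendsto_snd
      simpa using ENNReal.Tendsto.const_mul ((hlim.comp h2).add (hlim.comp h1)) (Or.inr hCt)
    · have hψ : MemLp (ψ : Cyl → ℂ) 4 volume := memLp_schwartz ψ (by norm_num) (by norm_num)
      have hle : ∀ n, ‖(∫ z, (w n : Cyl → ℂ) z * (ψ : Cyl → ℂ) z) - ofMemLp f hf ψ‖ₑ ≤
          eLpNorm (ψ : Cyl → ℂ) 4 volume * eLpNorm (f - (w n : Cyl → ℂ)) (4 / 3) volume := by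
        intro n
        have := enorm_integral_mul_sub_le hψ hf (hwm n)
        rw [(ofMemLp_isFunction f hf ψ).2]
        simpa only [mul_comm ((ψ : Cyl → ℂ) _)] using this
      refine tendsto_of_tendsto_of_tendsto_of_le_of_le tendsto_const_nhds ?_ (fun _ => zero_le) hle
      simpa using ENNReal.Tendsto.const_mul hlim (Or.inr hψ.eLpNorm_ne_top)
  refine ⟨⟨w, happ⟩, ?_⟩
  -- `bourgainNorm` asks for a sequence whose norms converge; compactness of `[0, ∞]` supplies a
  -- subsequence.
  obtain ⟨N, φ, hφ, hN⟩ := CompactSpace.tendsto_subseq fun n => schwartzNorm α μ 0 (-(1 / 3)) (w n)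
  have hN' : bourgainNorm α μ 0 (-(1 / 3)) (ofMemLp f hf) ≤ N :=
    sInf_le ⟨fun j => w (φ j), happ.comp_strictMono hφ, hN⟩
  refine hN'.trans ?_
  have hle : ∀ n, schwartzNorm α μ 0 (-(1 / 3)) (w (φ n)) ≤
      C * (eLpNorm f (4 / 3) volume + eLpNorm (f - (w (φ n) : Cyl → ℂ)) (4 / 3) volume) := by
    intro n
    refine (hC _).trans ?_
    gcongr
    calc eLpNorm (w (φ n) : Cyl → ℂ) (4 / 3) volume
        = eLpNorm (f - (f - (w (φ n) : Cyl → ℂ))) (4 / 3) volume := by rw [sub_sub_cancel]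
      _ ≤ _ := eLpNorm_sub_le hf.aestronglyMeasurable (hf.sub (hwm _)).aestronglyMeasurable
          one_le_four_thirds
  refine le_of_tendsto_of_tendsto' hN ?_ hle
  simpa using ENNReal.Tendsto.const_mul
    (tendsto_const_nhds.add (hlim.comp hφ.tendsto_atTop)) (Or.inr hCt)

end Benjamin

end

theorem theorem3p7 (α : ℝ) (hα : 0 < α) :
    ∃ C : ℝ≥0, 0 < C ∧ ∀ μ : ℝ,
      (∀ v ∈ Benjamin.bourgainSpace α μ 0 (1 / 3),
        ∃ f : Benjamin.Cyl → ℂ, MemLp f 4 volume ∧ v.IsFunction f ∧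
          eLpNorm f 4 volume ≤ C * Benjamin.bourgainNorm α μ 0 (1 / 3) v) ∧
      (∀ f : Benjamin.Cyl → ℂ, MemLp f (4 / 3) volume →
        ∃ u ∈ Benjamin.bourgainSpace α μ 0 (-(1 / 3)), u.IsFunction f ∧
          Benjamin.bourgainNorm α μ 0 (-(1 / 3)) u ≤ C * eLpNorm f (4 / 3) volume) := by
  obtain ⟨C₁, hC₁, h₁⟩ := Benjamin.eLpNorm_four_le_schwartzNorm hα
  obtain ⟨C₂, h₂⟩ := Benjamin.schwartzNorm_le_eLpNorm hα
  -- Both constants are fixed before `μ` is introduced, so their sum depends on `α` only.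
  refine ⟨C₁ + C₂, by positivity, fun μ => ⟨fun v hv => ?_, fun f hf => ?_⟩⟩
  · obtain ⟨f, hf, hvf, hle⟩ := Benjamin.exists_isFunction_of_mem_bourgainSpace hC₁ (h₁ μ) hv
    refine ⟨f, hf, hvf, hle.trans ?_⟩
    gcongr
    simp
  · obtain ⟨hmem, hle⟩ := Benjamin.ofMemLp_mem_bourgainSpace (h₂ μ) hf
    refine ⟨_, hmem, Benjamin.ofMemLp_isFunction f hf, hle.trans ?_⟩
    gcongr
    simp
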